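/- There is an absolute constant $C>0$ such that every ordered rooted tree $T$ of arbitrary arity with $n\ge 1$ nodes has a strictly-upward generalized LR-drawing (GLR-drawing) $\Gamma$ on the integer grid that has at most one bend per edge, width at most $C\,n^{0.48}$ and height at most $C\,n$. Here a drawing places the nodes at points of $\mathbb{Z}^2$ and represents each edge by a polygonal curve whose bends are points of $\mathbb{Z}^2$. Its width (height) is the number of grid columns (grid rows) that intersect it. It is planar if no two edges cross and no edge passes through a node that is not one of its ends, and order-preserving if the edges to the children leave each node in the given order, i.e. counterclockwise around each node one meets the edge to the parent (at the root: the vertical upward ray) and then the edges to the children in their given order. It is strictly upward if each node lies strictly above all its proper descendants and each edge is strictly decreasing in the $y$-direction from parent to child. For a root-to-leaf path $\pi$, a left (right) subtree of $\pi$ is a subtree rooted at a child $c$ of a node $v\in\pi$ such that $c$ comes before (after) the child of $v$ on $\pi$ in the order at $v$. A planar order-preserving drawing $\Gamma$ of $T$ is a GLR-drawing if for every node $v$ of $T$ the drawing that $\Gamma$ induces on the subtree $T_v$ rooted at $v$ has the following property: there is a path $\pi$ from $v$ to a leaf of $T_v$ that is drawn downward within a single column, and this column separates the left from the right subtrees of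 $\pi$, i.e. the drawings of the left (right) subtrees of $\pi$ in $T_v$ lie strictly to the left (right) of it. -/

import Mathlib

/-- A (finite, nonempty) ordered rooted tree of arbitrary arity: a root together with the list,
from left to right, of the subtrees rooted at its children. -/
inductive OrderedTree : Type where
  | node (children : List OrderedTree) : OrderedTree

namespace OrderedTree

/-- The subtrees rooted at the children of the root, from left to right. -/
def children : OrderedTree → List OrderedTree
  | node cs => cs

mutual
  /-- The number of nodes of an ordered rooted tree. -/
  def size : OrderedTree → ℕ
    | node cs => 1 + sizeList cs
  /-- The total number of nodes in a list of trees. -/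
  def sizeList : List OrderedTree → ℕ
    | [] => 0
    | c :: cs => size c + sizeList cs
end

theorem sizeList_eq (cs : List OrderedTree) : sizeList cs = (cs.map size).sum := by
  induction cs with
  | nil => simp [sizeList]
  | cons c cs ih => simp [sizeList, ih]

theorem size_node (cs : List OrderedTree) : size (node cs) = 1 + (cs.map size).sum := by
  rw [size, sizeList_eq]

/-- Nodes are named by their address: `[]` is the root and `a ++ [i]` is the `i`-th child
(counted from the left, starting with `0`) of the node `a`.
`T.subtreeAt a` is the subtree rooted at the node `a`, or `none` if `T` has no such node. -/
def subtreeAt : OrderedTree → List ℕ → Option OrderedTree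
  | T, [] => some T
  | T, i :: a =>
    match T.children[i]? with
    | none => none
    | some S => subtreeAt S a

/-- The set of (addresses of) nodes of `T`. -/
def nodes (T : OrderedTree) : Set (List ℕ) := {a | ∃ S, T.subtreeAt a = some S}

/-- `π` is a leaf of `T`; the addresses that are prefixes of `π` are then the nodes of the
root-to-leaf path that ends in `π`. -/
def IsLeaf (T : OrderedTree) (π : List ℕ) : Prop := T.subtreeAt π = some (node [])

end OrderedTree

/-- A grid point, as a point of the plane. -/
def gridPoint (p : ℤ × ℤ) : ℝ × ℝ := ((p.1 : ℝ), (p.2 : ℝ))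

/-- The polygonal curve through the given grid points. -/
def polyline : List (ℤ × ℤ) → Set (ℝ × ℝ)
  | [] => ∅
  | [p] => {gridPoint p}
  | p :: q :: l => segment ℝ (gridPoint p) (gridPoint q) ∪ polyline (q :: l)

/-- The polygonal curve through the given grid points does not meet itself. -/
def IsSimplePolyline : List (ℤ × ℤ) → Prop
  | [] => True
  | [_] => True
  | p :: q :: l => p ≠ q ∧
      segment ℝ (gridPoint p) (gridPoint q) ∩ polyline (q :: l) = {gridPoint q} ∧
      IsSimplePolyline (q :: l)

/-- The cross product of two plane vectors. It is positive iff the counterclockwise angle from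
`u` to `v` lies strictly between `0` and `π`. -/
def cross (u v : ℤ × ℤ) : ℤ := u.1 * v.2 - u.2 * v.1

/-- The directions of `u, v, w` are pairwise distinct and are met in this cyclic order when one
turns counterclockwise. (The three counterclockwise gaps between cyclically consecutive directions
add up to one full turn iff at least two of them lie strictly between `0` and `π`.) -/
def IsCCW (u v w : ℤ × ℤ) : Prop :=
  (0 < cross u v ∧ 0 < cross v w) ∨ (0 < cross v w ∧ 0 < cross w u) ∨
    (0 < cross w u ∧ 0 < cross u v)

/-- The data of a polyline drawing on the integer grid of an ordered rooted tree: the position of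
each node, and for each node other than the root the list of bends of the edge from its parent to
it, in the order from the parent to the node. The values at addresses that are not nodes of the
tree (and the bends at the root) are never used. The `y`-axis points upward. -/
structure GridDrawing where
  pos : List ℕ → ℤ × ℤ
  bends : List ℕ → List (ℤ × ℤ)

namespace GridDrawing

/-- The edge from the node `a` to its `i`-th child: end nodes and bends, in order. -/
def edgePoints (Γ : GridDrawing) (a : List ℕ) (i : ℕ) : List (ℤ × ℤ) :=
  Γ.pos a :: (Γ.bends (a ++ [i]) ++ [Γ.pos (a ++ [i])])

/-- The curve that represents the edge from `a` to its `i`-th child. -/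
def edgeCurve (Γ : GridDrawing) (a : List ℕ) (i : ℕ) : Set (ℝ × ℝ) :=
  polyline (Γ.edgePoints a i)

/-- The set of all points of the plane that the drawing of `T` occupies. -/
def support (Γ : GridDrawing) (T : OrderedTree) : Set (ℝ × ℝ) :=
  {p | ∃ a ∈ T.nodes, p = gridPoint (Γ.pos a)} ∪
    {p | ∃ a i, a ++ [i] ∈ T.nodes ∧ p ∈ Γ.edgeCurve a i}

/-- The number of columns (vertical grid lines) that intersect the drawing of `T`. -/
noncomputable def width (Γ : GridDrawing) (T : OrderedTree) : ℕ :=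
  Set.ncard {x : ℤ | ∃ p ∈ Γ.support T, p.1 = (x : ℝ)}

/-- The number of rows (horizontal grid lines) that intersect the drawing of `T`. -/
noncomputable def height (Γ : GridDrawing) (T : OrderedTree) : ℕ :=
  Set.ncard {y : ℤ | ∃ p ∈ Γ.support T, p.2 = (y : ℝ)}

/-- The drawing induced on the subtree rooted at the node `a`. -/
def induced (Γ : GridDrawing) (a : List ℕ) : GridDrawing where
  pos b := Γ.pos (a ++ b)
  bends b := Γ.bends (a ++ b)

/-- No crossings: distinct nodes are at distinct points, every edge is a simple curve, an edge
contains no node other than its two ends, and two edges meet only at a common end. -/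
structure IsPlanar (Γ : GridDrawing) (T : OrderedTree) : Prop where
  injective : Set.InjOn Γ.pos T.nodes
  simple : ∀ a i, a ++ [i] ∈ T.nodes → IsSimplePolyline (Γ.edgePoints a i)
  node_edge : ∀ c ∈ T.nodes, ∀ a i, a ++ [i] ∈ T.nodes →
    gridPoint (Γ.pos c) ∈ Γ.edgeCurve a i → c = a ∨ c = a ++ [i]
  edge_edge : ∀ a i b j, a ++ [i] ∈ T.nodes → b ++ [j] ∈ T.nodes → (a, i) ≠ (b, j) →
    ∀ p ∈ Γ.edgeCurve a i, p ∈ Γ.edgeCurve b j →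
      ∃ c, (c = a ∨ c = a ++ [i]) ∧ (c = b ∨ c = b ++ [j]) ∧ p = gridPoint (Γ.pos c)

/-- The direction in which the edge to the `i`-th child leaves the node `a`. -/
def childDir (Γ : GridDrawing) (a : List ℕ) (i : ℕ) : ℤ × ℤ :=
  (Γ.bends (a ++ [i]) ++ [Γ.pos (a ++ [i])]).head (by simp) - Γ.pos a

/-- The direction in which the edge to the parent leaves the node `a ++ [k]`. -/
def parentDir (Γ : GridDrawing) (a : List ℕ) (k : ℕ) : ℤ × ℤ :=
  (Γ.pos a :: Γ.bends (a ++ [k])).getLast (by simp) - Γ.pos (a ++ [k])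

/-- The order of the children is maintained: counterclockwise around each node one meets the edge
to the parent and then the edges to the children in their given order. At the root, the
vertical upward ray takes the place of the edge to the parent. (When all edges lead downward this
says that the children's edges leave every node in their given order from left to right.) -/
structure IsOrderPreserving (Γ : GridDrawing) (T : OrderedTree) : Prop where
  root : ∀ i j, i < j → [i] ∈ T.nodes → [j] ∈ T.nodes →
    IsCCW (0, 1) (Γ.childDir [] i) (Γ.childDir [] j)
  nonroot : ∀ a k i j, i < j → a ++ [k] ++ [i] ∈ T.nodes → a ++ [k] ++ [j] ∈ T.nodes →
    IsCCW (Γ.parentDir a k) (Γ.childDir (a ++ [k]) i) (Γ.childDir (a ++ [k]) j)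

/-- Every node is strictly above all its proper descendants, and every edge is strictly
decreasing in the `y`-direction on its way from the parent to the child. -/
structure IsStrictlyUpward (Γ : GridDrawing) (T : OrderedTree) : Prop where
  node_above : ∀ a b, b ≠ [] → a ++ b ∈ T.nodes → (Γ.pos (a ++ b)).2 < (Γ.pos a).2
  edge_monotone : ∀ a i, a ++ [i] ∈ T.nodes →
    (Γ.edgePoints a i).Pairwise (fun p q => q.2 < p.2)

/-- The root-to-leaf path to the leaf `π` is drawn vertically, downward, in the column `x`, and
that column separates the drawings of its left and of its right subtrees. -/
structure IsSeparatingPath (Γ : GridDrawing) (T : OrderedTree) (π : List ℕ) (x : ℤ) : Prop where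
  isLeaf : T.IsLeaf π
  node_aligned : ∀ a, a <+: π → (Γ.pos a).1 = x
  edge_vertical : ∀ a k, a ++ [k] <+: π → ∀ p ∈ Γ.edgeCurve a k, p.1 = (x : ℝ)
  above : ∀ a k, a ++ [k] <+: π → (Γ.pos (a ++ [k])).2 < (Γ.pos a).2
  left : ∀ a k i S, a ++ [k] <+: π → i < k → T.subtreeAt (a ++ [i]) = some S →
    ∀ p ∈ (Γ.induced (a ++ [i])).support S, p.1 < (x : ℝ)
  right : ∀ a k i S, a ++ [k] <+: π → k < i → T.subtreeAt (a ++ [i]) = some S →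
    ∀ p ∈ (Γ.induced (a ++ [i])).support S, (x : ℝ) < p.1

/-- A generalized LR-drawing: a planar order-preserving drawing for which the drawing of the whole
tree and the induced drawings of all rooted subtrees have a vertical root-to-leaf path whose
column separates the left from the right subtrees of the path. -/
structure IsGLR (Γ : GridDrawing) (T : OrderedTree) : Prop where
  planar : Γ.IsPlanar T
  orderPreserving : Γ.IsOrderPreserving T
  separatingPath : ∀ a S, T.subtreeAt a = some S → ∃ π x, (Γ.induced a).IsSeparatingPath S π x

end GridDrawing

-- Draw a root-to-leaf path in one column and put every left (right) subtree, drawn recursively,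
-- into its own horizontal strip to the left (right) of it. Strips on one side share their columns,
-- so the width obeys W(n) ≤ W(a) + W(b) + O(1), where a and b bound the sizes of the left and right
-- subtrees of the path, and the height stays linear. It therefore suffices to find a path with a^p
-- + b^p ≤ 0.9998 n^p for p = 0.48 (`exists_hasPath_fits`). The loss of 0.0002 n^p absorbs the
-- additive constant.
--
-- The path is grown greedily while a, b remain compatible in this sense (`Fits`). If no child can
-- continue it, there are l, r, of total size at most that of the children, such that a conflicts
-- with r and b with l (`Fits.split_or_large`). Then the path is abandoned for another one, which
-- leaves it at the subtree responsible for the current b (or a) and runs along the outer side of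
-- that subtree. On its outer side it meets only subtrees of size at most some g, on the other side
-- only subtrees of size at most max(a, b, n − a − b − g). The two conflicts make a, b, l, r so
-- large that g must be small, and `alternative_le` shows this pair to be compatible.
--
-- The drawing is built by `IsLayout.isGood`. The invariant `IsGood` places the root at the origin
-- as the only point in the top row, so a subtree meets its incoming edge only in its root.

-- Numerical inequalities for the exponent 0.48

/-- Weighted AM-GM for x and z^25 with weights 12/25 and 13/25. For fixed z > 0 this is the tangent
to x^0.48 at x = z^25, and a rational z makes its coefficients rational, so that linear arithmetic
can combine several tangents. -/
theorem rpow_mul_le_tangent {x z : ℝ} (hx : 0 ≤ x) (hz : 0 ≤ z) :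
    x ^ (0.48 : ℝ) * z ^ 13 ≤ (12 * x + 13 * z ^ 25) / 25 := by
  have h := Real.geom_mean_le_arith_mean2_weighted (w₁ := 0.48) (w₂ := 0.52) (by norm_num)
    (by norm_num) hx (pow_nonneg hz 25) (by norm_num)
  have e : (z ^ 25) ^ (0.52 : ℝ) = z ^ 13 := by
    rw [← Real.rpow_natCast_mul hz, ← Real.rpow_natCast]
    norm_num
  rw [e] at h
  linarith

/-- Concavity at the midpoint gives the factor 2^0.52, which is slightly below 1.434. -/
theorem rpow_add_rpow_le {x y : ℝ} (hx : 0 ≤ x) (hy : 0 ≤ y) :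
    x ^ (0.48 : ℝ) + y ^ (0.48 : ℝ) ≤ 1.434 * (x + y) ^ (0.48 : ℝ) := by
  have h2 : (2 : ℝ) ^ (0.52 : ℝ) ≤ 1.434 := by
    rw [show (0.52 : ℝ) = ((13 : ℕ) : ℝ) * (25 : ℝ)⁻¹ by norm_num, Real.rpow_natCast_mul (by norm_num)]
    rw [Real.rpow_inv_le_iff_of_pos (by norm_num) (by norm_num) (by norm_num)]
    norm_num
  have hc := (Real.concaveOn_rpow (p := (0.48 : ℝ)) (by norm_num) (by norm_num)).2
    (Set.mem_Ici.2 hx) (Set.mem_Ici.2 hy)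
    (show (0 : ℝ) ≤ 1 / 2 by norm_num) (show (0 : ℝ) ≤ 1 / 2 by norm_num) (by norm_num)
  simp only [smul_eq_mul] at hc
  have e : (1 / 2 * x + 1 / 2 * y) = (x + y) * 2⁻¹ := by ring
  rw [e, Real.mul_rpow (by positivity) (by norm_num), Real.inv_rpow (by norm_num)] at hc
  have e2 : (2 : ℝ) * (2 ^ (0.48 : ℝ))⁻¹ = 2 ^ (0.52 : ℝ) := by
    rw [← Real.rpow_neg (by norm_num)]
    nth_rw 1 [← Real.rpow_one 2]
    rw [← Real.rpow_add (by norm_num)]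
    norm_num
  have h3 : 0 ≤ (x + y) ^ (0.48 : ℝ) := by positivity
  nlinarith

/-- If `x` and `y` are too large in combination with `z`, and `s` in combination with `t`, then the
five numbers add up to more than `1`. -/
theorem five_sum_gt {x y z s t : ℝ} (hx : 0 ≤ x) (hy : 0 ≤ y) (hz : 0 ≤ z) (hs : 0 ≤ s)
    (ht : 0 ≤ t) (hxz : 0.9998 < x ^ (0.48 : ℝ) + z ^ (0.48 : ℝ))
    (hyz : 0.9998 < y ^ (0.48 : ℝ) + z ^ (0.48 : ℝ))
    (hst : 0.9998 < s ^ (0.48 : ℝ) + t ^ (0.48 : ℝ)) : 1 < x + y + z + s + t := by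
  -- The tangents touch near the minimiser of the sum: about 0.10 for x and y, 0.43 for z, 0.24 for
  -- s and t. The minimum is about 1.1.
  have tx := rpow_mul_le_tangent hx (z := 0.912) (by norm_num)
  have ty := rpow_mul_le_tangent hy (z := 0.912) (by norm_num)
  have tz := rpow_mul_le_tangent hz (z := 0.967) (by norm_num)
  have ts := rpow_mul_le_tangent hs (z := 0.944) (by norm_num)
  have tt := rpow_mul_le_tangent ht (z := 0.944) (by norm_num)
  norm_num at *
  linarith

/-- If `a` conflicts with `r` and `b` conflicts with `l`, then `g` is compatible with everything that
remains next to `a`, `b` and `g`, and with `a` and `b` themselves. -/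
theorem alternative_le {a b g l r : ℝ} (ha : 0 ≤ a) (hb : 0 ≤ b) (hg : 0 ≤ g) (hl : 0 ≤ l)
    (hr : 0 ≤ r) (hsum : a + b + g + l + r ≤ 1)
    (har : 0.9998 < a ^ (0.48 : ℝ) + r ^ (0.48 : ℝ))
    (hbl : 0.9998 < b ^ (0.48 : ℝ) + l ^ (0.48 : ℝ)) :
    (max (max a b) (1 - a - b - g)) ^ (0.48 : ℝ) + g ^ (0.48 : ℝ) ≤ 0.9998 := by
  rcases max_choice (max a b) (1 - a - b - g) with h | h
  · rw [h]
    by_contra! hc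
    rcases max_choice a b with h' | h' <;> rw [h'] at hc
    -- Here a conflicts with both g and r, while b conflicts with l; the other case is symmetric.
    · have := five_sum_gt hg hr ha hb hl (by linarith) (by linarith) hbl
      linarith
    · have := five_sum_gt hg hl hb ha hr (by linarith) (by linarith) har
      linarith
  · rw [h]
    by_contra! hc
    have hw : 0 ≤ 1 - a - b - g := by linarith
    -- With w = 1 − a − b − g ≥ l + r, adding the two conflicts gives a^p + b^p + 1.434 w^p >
    -- 1.9996, to be refuted together with w^p + g^p > 0.9998 and a + b + g + w = 1.
    have hlr := rpow_add_rpow_le hl hr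
    have hmono : (l + r) ^ (0.48 : ℝ) ≤ (1 - a - b - g) ^ (0.48 : ℝ) :=
      Real.rpow_le_rpow (by positivity) (by linarith) (by norm_num)
    -- The tangents touch at about 0.178 for a and b, 0.040 for g and 0.607 for w. These values sum
    -- to just over 1, so this case leaves little room.
    have ta := rpow_mul_le_tangent ha (z := 0.9332) (by norm_num)
    have tb := rpow_mul_le_tangent hb (z := 0.9332) (by norm_num)
    have tg := rpow_mul_le_tangent hg (z := 0.8792) (by norm_num)
    have tw := rpow_mul_le_tangent hw (z := 0.98023) (by norm_num)
    norm_num at ta tb tg tw hc har hbl hlr hmono ⊢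
    linarith

-- List maxima and compatible pairs of sizes

/-- The maximum of a list of natural numbers, `0` for the empty list. -/
def listMax (l : List ℕ) : ℕ := l.foldr max 0

theorem le_listMax {l : List ℕ} {x : ℕ} (h : x ∈ l) : x ≤ listMax l := by
  induction l with
  | nil => simp at h
  | cons y l ih =>
    simp only [listMax, List.foldr_cons] at ih ⊢
    rcases List.mem_cons.1 h with rfl | h
    · exact le_max_left _ _
    · exact (ih h).trans (le_max_right _ _)

theorem listMax_mem {l : List ℕ} (h : l ≠ []) : listMax l ∈ l := by
  induction l with
  | nil => exact absurd rfl h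
  | cons y l ih =>
    by_cases hl : l = []
    · simp [hl, listMax]
    · have := ih hl
      simp only [listMax, List.foldr_cons] at this ⊢
      rcases max_choice y (l.foldr max 0) with e | e <;> rw [e]
      · exact List.mem_cons_self
      · exact List.mem_cons_of_mem _ this

theorem listMax_le_sum (l : List ℕ) : listMax l ≤ l.sum := by
  by_cases h : l = []
  · simp [h, listMax]
  · exact List.single_le_sum (by simp) _ (listMax_mem h)

theorem listMax_le {l : List ℕ} {b : ℕ} (h : ∀ x ∈ l, x ≤ b) : listMax l ≤ b := by
  by_cases hl : l = []
  · simp [hl, listMax]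
  · exact h _ (listMax_mem hl)

/-- Left subtrees of size `a` and right subtrees of size `b` are small compared to a tree of
size `n`. -/
def Fits (n a b : ℕ) : Prop :=
  (a : ℝ) ^ (0.48 : ℝ) + (b : ℝ) ^ (0.48 : ℝ) ≤ 0.9998 * (n : ℝ) ^ (0.48 : ℝ)

namespace Fits

variable {n a b c d : ℕ}

theorem symm (h : Fits n a b) : Fits n b a := by
  unfold Fits at *
  linarith

theorem mono (h : Fits n c d) (ha : a ≤ c) (hb : b ≤ d) : Fits n a b := by
  unfold Fits at *
  have h1 : (a : ℝ) ^ (0.48 : ℝ) ≤ (c : ℝ) ^ (0.48 : ℝ) :=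
    Real.rpow_le_rpow (by positivity) (by exact_mod_cast ha) (by norm_num)
  have h2 : (b : ℝ) ^ (0.48 : ℝ) ≤ (d : ℝ) ^ (0.48 : ℝ) :=
    Real.rpow_le_rpow (by positivity) (by exact_mod_cast hb) (by norm_num)
  linarith

theorem iff_div (hn : 0 < n) : Fits n a b ↔
    ((a : ℝ) / n) ^ (0.48 : ℝ) + ((b : ℝ) / n) ^ (0.48 : ℝ) ≤ 0.9998 := by
  have hn' : (0 : ℝ) < (n : ℝ) ^ (0.48 : ℝ) := by positivity
  rw [Real.div_rpow (by positivity) (by positivity), Real.div_rpow (by positivity) (by positivity),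
    ← add_div, div_le_iff₀ hn', Fits]

theorem lt_five_sum {x y z s t : ℕ} (hn : 0 < n) (hxz : ¬ Fits n x z) (hyz : ¬ Fits n y z)
    (hst : ¬ Fits n s t) : n < x + y + z + s + t := by
  rw [iff_div hn, not_le] at *
  have h := five_sum_gt (by positivity) (by positivity) (by positivity) (by positivity)
    (by positivity) hxz hyz hst
  rw [← add_div, ← add_div, ← add_div, ← add_div, one_lt_div (by positivity)] at h
  exact_mod_cast h

theorem alternative {g l r : ℕ} (hn : 0 < n) (hsum : a + b + g + l + r ≤ n)
    (har : ¬ Fits n a r) (hbl : ¬ Fits n b l) :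
    Fits n (max (max a b) (n - a - b - g)) g := by
  rw [iff_div hn] at *
  rw [not_le] at har hbl
  have hn' : (0 : ℝ) < n := by positivity
  have h := alternative_le (a := a / n) (b := b / n) (g := g / n) (l := l / n) (r := r / n)
    (by positivity) (by positivity) (by positivity) (by positivity) (by positivity)
    (by
      rw [← add_div, ← add_div, ← add_div, ← add_div, div_le_one hn']
      exact_mod_cast hsum) har hbl
  convert h using 3
  rw [Nat.sub_sub, Nat.sub_sub, Nat.cast_max, Nat.cast_max, Nat.cast_sub (by omega),
    max_div_div_right hn'.le, ← max_div_div_right hn'.le]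
  congr 1
  push_cast
  field_simp
  ring

/-- Either some entry splits the list well, or two entries are both large. -/
theorem split_or_large {ns : List ℕ} (hn : 0 < n) (hne : ns ≠ []) (hab : Fits n a b)
    (hsum : a + b + ns.sum ≤ n) :
    (∃ xs c ys, ns = xs ++ c :: ys ∧ Fits n (max a (listMax xs)) (max b (listMax ys))) ∨
      ∃ l r, l + r ≤ ns.sum ∧ ¬ Fits n a r ∧ ¬ Fits n b l := by
  by_contra! hcon
  obtain ⟨hsplit, hlarge⟩ := hcon
  -- Everything is compared with the split at a largest entry c.
  obtain ⟨xs, ys, hns⟩ := List.append_of_mem (listMax_mem hne)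
  have hmax : ∀ x ∈ ns, x ≤ listMax ns := fun x hx => le_listMax hx
  generalize listMax ns = c at hns hmax
  have hs : ns.sum = xs.sum + c + ys.sum := by simp [hns, add_assoc]
  have hxs := listMax_le_sum xs
  have hys := listMax_le_sum ys
  -- Continuing at the first entry leaves a unchanged and raises b to at most max b c; as this split
  -- fails, a and c conflict. Dually for the last entry.
  have h1 : xs ≠ [] → ¬ Fits n a c := by
    intro hx hf
    obtain ⟨z, zs, rfl⟩ := List.exists_cons_of_ne_nil hx
    refine hsplit [] z (zs ++ c :: ys) (by simp [hns]) ?_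
    rcases max_choice b (listMax (zs ++ c :: ys)) with e | e <;> rw [e]
    · simpa [listMax] using hab
    · refine hf.mono (by simp [listMax]) (listMax_le fun x hx => hmax x ?_)
      rw [hns]
      simpa using Or.inr (by simpa using hx)
  have h2 : ys ≠ [] → ¬ Fits n b c := by
    intro hy hf
    obtain ⟨zs, z, rfl⟩ := (List.eq_nil_or_concat' ys).resolve_left hy
    refine hsplit (xs ++ c :: zs) z [] (by simp [hns]) ?_
    rcases max_choice a (listMax (xs ++ c :: zs)) with e | e <;> rw [e]
    · simpa [listMax] using hab
    · refine hf.symm.mono (listMax_le fun x hx => hmax x ?_) (by simp [listMax])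
      rw [hns]
      simp only [List.mem_append, List.mem_cons] at hx ⊢
      tauto
  -- If ys is nonempty, b conflicts with c, so l = c and r = max ys would be the excluded pair.
  have h3 : ¬ Fits n a (listMax ys) → False := by
    intro hf
    by_cases hy : ys = []
    · exact hf (hab.mono le_rfl (by simp [hy, listMax]))
    · exact h2 hy (hlarge c (listMax ys) (by omega) hf)
  have h4 : ¬ Fits n b (listMax xs) → False := by
    intro hf
    by_cases hx : xs = []
    · exact hf (hab.symm.mono le_rfl (by simp [hx, listMax]))
    · exact hf (hlarge (listMax xs) c (by omega) (h1 hx))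
  have hm := hsplit xs c ys hns
  rcases max_choice a (listMax xs) with e | e <;> rcases max_choice b (listMax ys) with e' | e' <;>
    rw [e, e'] at hm
  · exact hm hab
  · exact h3 hm
  · exact h4 fun h => hm h.symm
  · by_cases hx : xs = []
    · exact h3 fun h => hm (h.mono (by simp [hx, listMax]) le_rfl)
    by_cases hy : ys = []
    · exact h4 fun h => hm (h.symm.mono le_rfl (by simp [hy, listMax]))
    -- Now a and b both conflict with c, and max xs with max ys, which needs total size above n.
    have := lt_five_sum hn (h1 hx) (h2 hy) hm
    omega

end Fits

-- Existence of a path with compatible side subtrees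

namespace OrderedTree

/-- Some root-to-leaf path of the tree has only left subtrees of size at most `a` and only right
subtrees of size at most `b`. -/
inductive HasPath (a b : ℕ) : OrderedTree → Prop
  | leaf : HasPath a b (node [])
  | step (xs : List OrderedTree) (c : OrderedTree) (ys : List OrderedTree)
      (left : ∀ x ∈ xs, x.size ≤ a) (right : ∀ y ∈ ys, y.size ≤ b) (rest : HasPath a b c) :
      HasPath a b (node (xs ++ c :: ys))

theorem HasPath.mono {a b a' b' : ℕ} {T : OrderedTree} (h : HasPath a b T) (ha : a ≤ a')
    (hb : b ≤ b') : HasPath a' b' T := by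
  induction h with
  | leaf => exact .leaf
  | step xs c ys left right _ ih =>
    exact .step xs c ys (fun x hx => (left x hx).trans ha) (fun y hy => (right y hy).trans hb) ih

theorem size_le_sum_of_mem {cs : List OrderedTree} {c : OrderedTree} (h : c ∈ cs) :
    c.size ≤ (cs.map size).sum :=
  List.single_le_sum (by simp) _ (List.mem_map_of_mem h)

theorem size_lt_of_mem {cs : List OrderedTree} {c : OrderedTree} (h : c ∈ cs) :
    c.size < (node cs).size := by
  have := size_le_sum_of_mem h
  rw [size_node]
  omega

theorem size_pos (T : OrderedTree) : 0 < T.size := by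
  obtain ⟨cs⟩ := T
  rw [size_node]
  omega

/-- Always descending to the last child leaves nothing on the right. This and its mirror image
finish the fallback paths. -/
theorem hasPath_rightmost (T : OrderedTree) : HasPath T.size 0 T := by
  induction hn : T.size using Nat.strong_induction_on generalizing T with
  | _ n ih =>
    obtain ⟨cs⟩ := T
    rcases List.eq_nil_or_concat' cs with rfl | ⟨xs, c, rfl⟩
    · exact .leaf
    · have hc := size_lt_of_mem (cs := xs ++ [c]) (c := c) (by simp)
      exact .step xs c [] (fun x hx => hn ▸ (size_lt_of_mem (cs := xs ++ [c]) (by simp [hx])).le)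
        (by simp)
        ((ih _ (hn ▸ hc) c rfl).mono (hn ▸ hc.le) le_rfl)

theorem hasPath_leftmost (T : OrderedTree) : HasPath 0 T.size T := by
  induction hn : T.size using Nat.strong_induction_on generalizing T with
  | _ n ih =>
    obtain ⟨cs⟩ := T
    rcases cs with _ | ⟨c, ys⟩
    · exact .leaf
    · have hc := size_lt_of_mem (cs := c :: ys) (c := c) (by simp)
      exact .step [] c ys (by simp) (fun x hx => hn ▸ (size_lt_of_mem (by simp [hx])).le)
        ((ih _ (hn ▸ hc) c rfl).mono le_rfl (hn ▸ hc.le))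

theorem exists_split_listMax {ys : List OrderedTree} (h : 0 < listMax (ys.map size)) :
    ∃ ys₁ y ys₂, ys = ys₁ ++ y :: ys₂ ∧ y.size = listMax (ys.map size) := by
  have hne : ys.map size ≠ [] := by
    intro h0
    simp [h0, listMax] at h
  obtain ⟨y, hy, hys⟩ := List.mem_map.1 (listMax_mem hne)
  obtain ⟨ys₁, ys₂, e⟩ := List.append_of_mem hy
  exact ⟨ys₁, y, ys₂, e, hys⟩

/-- Greedy extension of a path in `T` that has reached the root of the subtree `S`, with left
subtrees of size at most `a` and right subtrees of size at most `b` so far; `halt` is a fallback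
that leaves the path at its largest left or right subtree. -/
theorem exists_hasPath_fits_aux (T S : OrderedTree) (a b : ℕ) (hab : Fits T.size a b)
    (hcont : ∀ a' b', a ≤ a' → b ≤ b' → HasPath a' b' S → HasPath a' b' T)
    (halt : ∃ g, a + b + g + S.size ≤ T.size ∧
      (HasPath (max (max a b) (T.size - a - b - g)) g T ∨
        HasPath g (max (max a b) (T.size - a - b - g)) T)) :
    ∃ a b, HasPath a b T ∧ Fits T.size a b := by
  induction hm : S.size using Nat.strong_induction_on generalizing S a b with
  | _ m ih =>
    subst hm
    obtain ⟨g, hg, hpath⟩ := halt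
    obtain ⟨cs⟩ := S
    by_cases hcs : cs = []
    · subst hcs
      exact ⟨a, b, hcont a b le_rfl le_rfl .leaf, hab⟩
    have hsize := size_node cs
    rcases Fits.split_or_large T.size_pos (ns := cs.map size) (by simpa using hcs) hab (by omega)
      with ⟨xs', c', ys', he, hf⟩ | ⟨l, r, hlr, har, hbl⟩
    · obtain ⟨xs, zs, rfl, rfl, hzs⟩ := List.map_eq_append_iff.1 he
      obtain ⟨c, ys, rfl, rfl, rfl⟩ := List.map_eq_cons_iff.1 hzs
      have hsum : ((xs ++ c :: ys).map size).sum =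
          (xs.map size).sum + c.size + (ys.map size).sum := by simp [add_assoc]
      have hx : ∀ x ∈ xs, x.size ≤ listMax (xs.map size) :=
        fun x hx => le_listMax (List.mem_map_of_mem hx)
      have hy : ∀ y ∈ ys, y.size ≤ listMax (ys.map size) :=
        fun y hy => le_listMax (List.mem_map_of_mem hy)
      have hxs := listMax_le_sum (xs.map size)
      have hys := listMax_le_sum (ys.map size)
      refine ih c.size (size_lt_of_mem (by simp)) c _ _ hf ?_ ?_ rfl
      · intro a' b' ha' hb' h
        refine hcont a' b' (by omega) (by omega) (.step xs c ys (fun x h' => ?_) (fun y h' => ?_) h)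
        · have := hx x h'
          omega
        · have := hy y h'
          omega
      -- If b grows, a largest right sibling y gives a new fallback: enter y and follow its
      -- rightmost path. Its right subtrees are old ones or right siblings of y, which defines g. On
      -- its left are old left subtrees, parts of y (of size at most the new b), and left siblings
      -- of y, including c, all of which are bounded by the stated maximum.
      · rcases lt_or_ge b (listMax (ys.map size)) with hlt | hge
        · obtain ⟨ys₁, y, ys₂, rfl, hy0⟩ := exists_split_listMax (by omega : 0 < listMax (ys.map size))
          have hsum' : ((ys₁ ++ y :: ys₂).map size).sum =
            (ys₁.map size).sum + y.size + (ys₂.map size).sum := by simp [add_assoc]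
          have hys₂ := listMax_le_sum (ys₂.map size)
          refine ⟨max b (listMax (ys₂.map size)), by omega, Or.inl (hcont _ _ (by omega) (by omega) ?_)⟩
          have := HasPath.step (a := max (max (max a (listMax (xs.map size)))
            (max b (listMax ((ys₁ ++ y :: ys₂).map size)))) (T.size -
              max a (listMax (xs.map size)) - max b (listMax ((ys₁ ++ y :: ys₂).map size)) -
              max b (listMax (ys₂.map size)))) (b := max b (listMax (ys₂.map size)))
            (xs ++ c :: ys₁) y ys₂ (fun x h' => ?_) (fun x h' => ?_)
            ((hasPath_rightmost y).mono (by omega) (by omega))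
          · simpa using this
          · simp only [List.mem_append, List.mem_cons] at h'
            rcases h' with h' | rfl | h'
            · have := hx x h'
              omega
            · omega
            · have := size_le_sum_of_mem h'
              omega
          · have := le_listMax (List.mem_map_of_mem (f := size) h')
            omega
        -- If only a grows, the mirrored fallback is used; if neither grows, the old one survives
        -- because S only shrinks.
        rcases lt_or_ge a (listMax (xs.map size)) with hlt' | hge'
        · obtain ⟨xs₁, x, xs₂, rfl, hx0⟩ := exists_split_listMax (by omega : 0 < listMax (xs.map size))
          have hsum' : ((xs₁ ++ x :: xs₂).map size).sum =
            (xs₁.map size).sum + x.size + (xs₂.map size).sum := by simp [add_assoc]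
          have hxs₁ := listMax_le_sum (xs₁.map size)
          refine ⟨max a (listMax (xs₁.map size)), by omega, Or.inr (hcont _ _ (by omega) (by omega) ?_)⟩
          have := HasPath.step (b := max (max (max a (listMax ((xs₁ ++ x :: xs₂).map size)))
            (max b (listMax (ys.map size)))) (T.size -
              max a (listMax ((xs₁ ++ x :: xs₂).map size)) - max b (listMax (ys.map size)) -
              max a (listMax (xs₁.map size)))) (a := max a (listMax (xs₁.map size)))
            xs₁ x (xs₂ ++ c :: ys) (fun z h' => ?_) (fun z h' => ?_)
            ((hasPath_leftmost x).mono (by omega) (by omega))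
          · simpa using this
          · have := le_listMax (List.mem_map_of_mem (f := size) h')
            omega
          · simp only [List.mem_append, List.mem_cons] at h'
            rcases h' with h' | rfl | h'
            · have := size_le_sum_of_mem h'
              omega
            · omega
            · have := hy z h'
              omega
        · rw [max_eq_left hge, max_eq_left hge']
          exact ⟨g, by omega, hpath⟩
    -- The greedy path is stuck, so the fallback is taken.
    · have := Fits.alternative (g := g) T.size_pos (by omega) har hbl
      rcases hpath with h | h
      · exact ⟨_, _, h, this⟩
      · exact ⟨_, _, h, this.symm⟩

theorem exists_hasPath_fits (T : OrderedTree) : ∃ a b, HasPath a b T ∧ Fits T.size a b := by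
  -- Initially g = 0, with the rightmost path of T as fallback.
  refine exists_hasPath_fits_aux T T 0 0 ?_ (fun _ _ _ _ h => h) ⟨0, by simp, Or.inl ?_⟩
  · simp only [Fits]
    rw [Nat.cast_zero, Real.zero_rpow (by norm_num), add_zero]
    positivity
  · simpa using hasPath_rightmost T

end OrderedTree

-- Polylines and directions

theorem gridPoint_add (p q : ℤ × ℤ) : gridPoint (p + q) = gridPoint p + gridPoint q := by
  simp [gridPoint]

theorem gridPoint_zero : gridPoint 0 = 0 := by
  simp [gridPoint]

theorem gridPoint_injective : Function.Injective gridPoint := by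
  intro p q h
  simpa [gridPoint, Prod.ext_iff] using h

theorem polyline_map_add (o : ℤ × ℤ) (l : List (ℤ × ℤ)) (p : ℝ × ℝ) :
    p ∈ polyline (l.map (o + ·)) ↔ p - gridPoint o ∈ polyline l := by
  induction l with
  | nil => simp [polyline]
  | cons q l ih =>
    cases l with
    | nil => simp [polyline, gridPoint_add, sub_eq_iff_eq_add']
    | cons r l =>
      simp only [List.map_cons, polyline, Set.mem_union] at ih ⊢
      rw [ih, gridPoint_add, gridPoint_add,
        ← mem_segment_translate ℝ (gridPoint o) (x := p - gridPoint o), add_sub_cancel]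

theorem head_mem_polyline (p : ℤ × ℤ) (l : List (ℤ × ℤ)) : gridPoint p ∈ polyline (p :: l) := by
  cases l with
  | nil => exact rfl
  | cons q l => exact Or.inl (left_mem_segment ℝ _ _)

theorem mem_segment_gridPoint {p q : ℤ × ℤ} {z : ℝ × ℝ}
    (hz : z ∈ segment ℝ (gridPoint p) (gridPoint q)) :
    ∃ t : ℝ, 0 ≤ t ∧ t ≤ 1 ∧ z.1 = p.1 + t * (q.1 - p.1) ∧ z.2 = p.2 + t * (q.2 - p.2) := by
  rw [segment_eq_image'] at hz
  obtain ⟨t, ⟨h0, h1⟩, rfl⟩ := hz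
  exact ⟨t, h0, h1, by simp [gridPoint], by simp [gridPoint]⟩

theorem snd_le_of_mem_segment {p q : ℤ × ℤ} {z : ℝ × ℝ} (h : q.2 < p.2)
    (hz : z ∈ segment ℝ (gridPoint p) (gridPoint q)) :
    (q.2 : ℝ) ≤ z.2 ∧ z.2 ≤ p.2 ∧ (z.2 = p.2 → z = gridPoint p) := by
  have h' : (q.2 : ℝ) < p.2 := by exact_mod_cast h
  obtain ⟨t, h0, h1, hx, hy⟩ := mem_segment_gridPoint hz
  refine ⟨by nlinarith, by nlinarith, fun he => ?_⟩
  have ht : t = 0 := by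
    rcases mul_eq_zero.1 (show t * ((q.2 : ℝ) - p.2) = 0 by linarith) with h | h
    · exact h
    · linarith
  subst ht
  ext <;> simp [gridPoint, hx, hy]

theorem snd_le_of_mem_polyline {p : ℤ × ℤ} {l : List (ℤ × ℤ)} {z : ℝ × ℝ}
    (h : (p :: l).Pairwise (fun p q => q.2 < p.2)) (hz : z ∈ polyline (p :: l)) :
    z.2 ≤ p.2 ∧ (z.2 = p.2 → z = gridPoint p) := by
  induction l generalizing p with
  | nil =>
    have : z = gridPoint p := hz
    simp [this, gridPoint]
  | cons q l ih =>
    have hpq : q.2 < p.2 := List.rel_of_pairwise_cons h List.mem_cons_self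
    rcases hz with hz | hz
    · exact (snd_le_of_mem_segment hpq hz).2
    · have h1 := (ih h.of_cons hz).1
      have h2 : (q.2 : ℝ) < p.2 := by exact_mod_cast hpq
      exact ⟨by linarith, fun he => by linarith⟩

/-- The remainder of a strictly descending curve lies at or below its first point and touches that
height only there. -/
theorem isSimplePolyline_of_pairwise {l : List (ℤ × ℤ)}
    (h : l.Pairwise (fun p q => q.2 < p.2)) : IsSimplePolyline l := by
  induction l with
  | nil => trivial
  | cons p l ih =>
    cases l with
    | nil => trivial
    | cons q l =>
      have hpq : q.2 < p.2 := List.rel_of_pairwise_cons h List.mem_cons_self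
      refine ⟨?_, ?_, ih h.of_cons⟩
      · rintro rfl
        exact lt_irrefl _ hpq
      · ext z
        simp only [Set.mem_inter_iff, Set.mem_singleton_iff]
        constructor
        · rintro ⟨h1, h2⟩
          have h3 := snd_le_of_mem_polyline h.of_cons h2
          exact h3.2 (le_antisymm h3.1 (snd_le_of_mem_segment hpq h1).1)
        · rintro rfl
          exact ⟨right_mem_segment ℝ _ _, head_mem_polyline _ _⟩

/-- If `u` points upward and `v`, `w` point downward, then their cyclic order is the left-to-right
order of `v` and `w`. -/
theorem isCCW_iff_cross_pos {u v w : ℤ × ℤ} (hu : 0 < u.2) (hv : v.2 < 0) (hw : w.2 < 0) :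
    IsCCW u v w ↔ 0 < cross v w := by
  unfold IsCCW cross
  constructor
  · rintro (h | h | ⟨h1, h2⟩)
    · exact h.2
    · exact h.1
    · by_contra! hc
      -- Second coordinate of the identity cross(u,v) w + cross(v,w) u + cross(w,u) v = 0.
      nlinarith [mul_pos (neg_pos.2 hv) h1, mul_pos (neg_pos.2 hw) h2, mul_nonneg hu.le (sub_nonneg.2 hc)]
  · intro h
    by_cases h1 : 0 < u.1 * v.2 - u.2 * v.1
    · exact Or.inl ⟨h1, h⟩
    · by_cases h2 : 0 < w.1 * u.2 - w.2 * u.1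
      · exact Or.inr (Or.inl ⟨h, h2⟩)
      · nlinarith [mul_nonneg (neg_pos.2 hv).le (sub_nonneg.2 (not_lt.1 h2)),
          mul_nonneg (neg_pos.2 hw).le (sub_nonneg.2 (not_lt.1 h1)), mul_pos hu h]

-- Node addresses

namespace OrderedTree

theorem subtreeAt_cons (cs : List OrderedTree) (i : ℕ) (a : List ℕ) (S : OrderedTree) :
    (node cs).subtreeAt (i :: a) = some S ↔ ∃ R, cs[i]? = some R ∧ R.subtreeAt a = some S := by
  rw [subtreeAt]
  simp only [children]
  cases cs[i]? <;> simp

theorem nil_mem_nodes (T : OrderedTree) : [] ∈ T.nodes := ⟨T, by rw [subtreeAt]⟩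

theorem cons_mem_nodes {cs : List OrderedTree} {i : ℕ} {a : List ℕ} :
    i :: a ∈ (node cs).nodes ↔ ∃ R, cs[i]? = some R ∧ a ∈ R.nodes := by
  simp only [nodes, Set.mem_ofPred_eq, subtreeAt_cons]
  exact ⟨fun ⟨S, R, h1, h2⟩ => ⟨R, h1, S, h2⟩, fun ⟨R, h1, S, h2⟩ => ⟨S, R, h1, h2⟩⟩

theorem mem_nodes_of_append {T : OrderedTree} {a b : List ℕ} (h : a ++ b ∈ T.nodes) :
    a ∈ T.nodes := by
  induction a generalizing T with
  | nil => exact nil_mem_nodes T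
  | cons i a ih =>
    obtain ⟨cs⟩ := T
    obtain ⟨R, hR, h⟩ := cons_mem_nodes.1 h
    exact cons_mem_nodes.2 ⟨R, hR, ih h⟩

end OrderedTree

open OrderedTree

-- Translates and the recursive invariant

namespace GridDrawing

variable {Γ Γ' : GridDrawing} {T : OrderedTree} {o : ℤ × ℤ}

theorem node_mem_support {a : List ℕ} (h : a ∈ T.nodes) : gridPoint (Γ.pos a) ∈ Γ.support T :=
  Or.inl ⟨a, h, rfl⟩

theorem edge_mem_support {a : List ℕ} {i : ℕ} (h : a ++ [i] ∈ T.nodes) {p : ℝ × ℝ}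
    (hp : p ∈ Γ.edgeCurve a i) : p ∈ Γ.support T :=
  Or.inr ⟨a, i, h, hp⟩

/-- `Γ'` is the translate of `Γ` by `o`. -/
structure IsTranslate (Γ' Γ : GridDrawing) (o : ℤ × ℤ) : Prop where
  pos : ∀ a, Γ'.pos a = o + Γ.pos a
  bends : ∀ a i, Γ'.bends (a ++ [i]) = (Γ.bends (a ++ [i])).map (o + ·)

namespace IsTranslate

theorem edgePoints (h : IsTranslate Γ' Γ o) (a : List ℕ) (i : ℕ) :
    Γ'.edgePoints a i = (Γ.edgePoints a i).map (o + ·) := by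
  simp [GridDrawing.edgePoints, h.pos, h.bends]

theorem mem_edgeCurve (h : IsTranslate Γ' Γ o) {a : List ℕ} {i : ℕ} {p : ℝ × ℝ} :
    p ∈ Γ'.edgeCurve a i ↔ p - gridPoint o ∈ Γ.edgeCurve a i := by
  rw [edgeCurve, h.edgePoints, polyline_map_add, edgeCurve]

theorem mem_support (h : IsTranslate Γ' Γ o) {p : ℝ × ℝ} :
    p ∈ Γ'.support T ↔ p - gridPoint o ∈ Γ.support T := by
  simp only [support, Set.mem_union, Set.mem_ofPred_eq, h.mem_edgeCurve, h.pos, gridPoint_add,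
    sub_eq_iff_eq_add']

theorem induced (h : IsTranslate Γ' Γ o) (a : List ℕ) :
    IsTranslate (Γ'.induced a) (Γ.induced a) o :=
  ⟨fun b => h.pos (a ++ b), fun b i => by
    simpa [GridDrawing.induced] using h.bends (a ++ b) i⟩

theorem isSeparatingPath (h : IsTranslate Γ' Γ o) {π : List ℕ} {x : ℤ}
    (hπ : Γ.IsSeparatingPath T π x) : Γ'.IsSeparatingPath T π (o.1 + x) where
  isLeaf := hπ.isLeaf
  node_aligned a ha := by simp [h.pos, hπ.node_aligned a ha]
  edge_vertical a k ha p hp := by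
    have := hπ.edge_vertical a k ha _ (h.mem_edgeCurve.1 hp)
    simp only [gridPoint, Prod.fst_sub] at this
    push_cast
    linarith
  above a k ha := by simpa [h.pos] using hπ.above a k ha
  left a k i S ha hi hS p hp := by
    have := hπ.left a k i S ha hi hS _ ((h.induced _).mem_support.1 hp)
    simp only [gridPoint, Prod.fst_sub] at this
    push_cast
    linarith
  right a k i S ha hi hS p hp := by
    have := hπ.right a k i S ha hi hS _ ((h.induced _).mem_support.1 hp)
    simp only [gridPoint, Prod.fst_sub] at this
    push_cast
    linarith

end IsTranslate

/-- A drawing with its root at the origin, at most one bend per edge, `l` columns to the left and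
`r` columns to the right of the root, that has the defining properties of strictly-upward
GLR-drawings in a form that is convenient for recursion. -/
structure IsGood (Γ : GridDrawing) (T : OrderedTree) (l r : ℕ) : Prop where
  root : Γ.pos [] = 0
  injective : Set.InjOn Γ.pos T.nodes
  node_edge : ∀ c ∈ T.nodes, ∀ a i, a ++ [i] ∈ T.nodes →
    gridPoint (Γ.pos c) ∈ Γ.edgeCurve a i → c = a ∨ c = a ++ [i]
  edge_edge : ∀ a i b j, a ++ [i] ∈ T.nodes → b ++ [j] ∈ T.nodes → (a, i) ≠ (b, j) →
    ∀ p ∈ Γ.edgeCurve a i, p ∈ Γ.edgeCurve b j →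
      ∃ c, (c = a ∨ c = a ++ [i]) ∧ (c = b ∨ c = b ++ [j]) ∧ p = gridPoint (Γ.pos c)
  edge_monotone : ∀ a i, a ++ [i] ∈ T.nodes →
    (Γ.edgePoints a i).Pairwise (fun p q => q.2 < p.2)
  bends_length : ∀ a i, a ++ [i] ∈ T.nodes → (Γ.bends (a ++ [i])).length ≤ 1
  cross_pos : ∀ a i j, i < j → a ++ [i] ∈ T.nodes → a ++ [j] ∈ T.nodes →
    0 < cross (Γ.childDir a i) (Γ.childDir a j)
  separatingPath : ∀ a S, T.subtreeAt a = some S → ∃ π x, (Γ.induced a).IsSeparatingPath S π x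
  bounds : ∀ p ∈ Γ.support T, -(l : ℝ) ≤ p.1 ∧ p.1 ≤ r ∧ -(2 * T.size - 2 : ℝ) ≤ p.2 ∧ p.2 ≤ 0 ∧
    (p.2 = 0 → p = 0)

namespace IsGood

variable {l r : ℕ}

theorem childDir_neg (h : Γ.IsGood T l r) {a : List ℕ} {i : ℕ} (hi : a ++ [i] ∈ T.nodes) :
    (Γ.childDir a i).2 < 0 := by
  have := List.rel_of_pairwise_cons (h.edge_monotone a i hi) (List.head_mem (by simp))
  simpa [childDir] using this

theorem parentDir_pos (h : Γ.IsGood T l r) {a : List ℕ} {i : ℕ} (hi : a ++ [i] ∈ T.nodes) :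
    0 < (Γ.parentDir a i).2 := by
  have h1 := h.edge_monotone a i hi
  rw [edgePoints, ← List.cons_append, List.pairwise_append] at h1
  have := h1.2.2 _ (List.getLast_mem (by simp)) _ (List.mem_singleton_self _)
  simpa [parentDir] using this

theorem pos_lt (h : Γ.IsGood T l r) {a b : List ℕ} (hb : b ≠ []) (hab : a ++ b ∈ T.nodes) :
    (Γ.pos (a ++ b)).2 < (Γ.pos a).2 := by
  induction b using List.reverseRecOn with
  | nil => exact absurd rfl hb
  | append_singleton b i ih =>
    rw [← List.append_assoc] at hab ⊢
    have h1 : (Γ.pos (a ++ b ++ [i])).2 < (Γ.pos (a ++ b)).2 :=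
      List.rel_of_pairwise_cons (h.edge_monotone _ i hab) (by simp)
    by_cases hb' : b = []
    · simpa [hb'] using h1
    · exact h1.trans (ih hb' (mem_nodes_of_append hab))

theorem isPlanar (h : Γ.IsGood T l r) : Γ.IsPlanar T where
  injective := h.injective
  simple a i hi := isSimplePolyline_of_pairwise (h.edge_monotone a i hi)
  node_edge := h.node_edge
  edge_edge := h.edge_edge

theorem isStrictlyUpward (h : Γ.IsGood T l r) : Γ.IsStrictlyUpward T where
  node_above _ _ hb hab := h.pos_lt hb hab
  edge_monotone := h.edge_monotone

theorem isOrderPreserving (h : Γ.IsGood T l r) : Γ.IsOrderPreserving T where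
  root i j hij hi hj := (isCCW_iff_cross_pos (by norm_num) (h.childDir_neg (a := []) hi)
    (h.childDir_neg (a := []) hj)).2 (h.cross_pos [] i j hij hi hj)
  nonroot a k i j hij hi hj := (isCCW_iff_cross_pos
    (h.parentDir_pos (mem_nodes_of_append hi)) (h.childDir_neg hi)
    (h.childDir_neg hj)).2 (h.cross_pos _ i j hij hi hj)

theorem isGLR (h : Γ.IsGood T l r) : Γ.IsGLR T :=
  ⟨h.isPlanar, h.isOrderPreserving, h.separatingPath⟩

theorem width_le (h : Γ.IsGood T l r) : Γ.width T ≤ l + r + 1 := by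
  have hsub : {x : ℤ | ∃ p ∈ Γ.support T, p.1 = (x : ℝ)} ⊆ ((Finset.Icc (-(l : ℤ)) r : Finset ℤ) : Set ℤ) := by
    rintro x ⟨p, hp, hx⟩
    obtain ⟨h1, h2, -⟩ := h.bounds p hp
    rw [hx] at h1 h2
    rw [Finset.coe_Icc, Set.mem_Icc]
    exact ⟨by exact_mod_cast h1, by exact_mod_cast h2⟩
  refine (Set.ncard_le_ncard hsub (Finset.finite_toSet _)).trans ?_
  rw [Set.ncard_coe_finset, Int.card_Icc]
  omega

theorem height_le (h : Γ.IsGood T l r) : Γ.height T ≤ 2 * T.size := by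
  have hsub : {y : ℤ | ∃ p ∈ Γ.support T, p.2 = (y : ℝ)} ⊆
      ((Finset.Icc (-(2 * T.size - 2 : ℤ)) 0 : Finset ℤ) : Set ℤ) := by
    rintro x ⟨p, hp, hx⟩
    obtain ⟨-, -, h1, h2, -⟩ := h.bounds p hp
    rw [hx] at h1 h2
    rw [Finset.coe_Icc, Set.mem_Icc]
    exact ⟨by exact_mod_cast h1, by exact_mod_cast h2⟩
  refine (Set.ncard_le_ncard hsub (Finset.finite_toSet _)).trans ?_
  rw [Set.ncard_coe_finset, Int.card_Icc]
  omega

end IsGood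

/-- The bounds are arbitrary because the column budget stays fixed along a whole path. -/
theorem isGood_leaf (l r : ℕ) : IsGood ⟨fun _ => 0, fun _ => []⟩ (node []) l r := by
  have hn : ∀ a, a ∈ (node []).nodes → a = [] := by
    intro a ha
    cases a with
    | nil => rfl
    | cons i a => simp [cons_mem_nodes] at ha
  have he : ∀ a i, a ++ [i] ∈ (node []).nodes → False := fun a i h => by simpa using hn _ h
  refine ⟨rfl, ?_, fun _ _ a i h => (he a i h).elim, fun a i _ _ h => (he a i h).elim,
    fun a i h => (he a i h).elim, fun a i h => (he a i h).elim,
    fun a i _ _ h => (he a i h).elim, ?_, ?_⟩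
  · intro a ha b hb _
    rw [hn a ha, hn b hb]
  · intro a S hS
    obtain rfl := hn a ⟨S, hS⟩
    rw [subtreeAt, Option.some_inj] at hS
    subst hS
    refine ⟨[], 0, by rw [IsLeaf, subtreeAt], fun _ _ => rfl, ?_, ?_, ?_, ?_⟩
    all_goals
      intro a k
      simp
  · rintro p (⟨a, -, rfl⟩ | ⟨a, i, h, -⟩)
    · simp [gridPoint_zero, size_node]
    · exact (he a i h).elim

end GridDrawing

-- Assembling the drawings of the subtrees

namespace GridDrawing

/-- The drawing with the root at the origin in which the `i`-th subtree is drawn as in `Γ i`,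
translated by `o i`, and the edge to it has the bends `be i`. -/
def assemble (Γ : ℕ → GridDrawing) (o : ℕ → ℤ × ℤ) (be : ℕ → List (ℤ × ℤ)) : GridDrawing where
  pos
    | [] => 0
    | i :: a => o i + (Γ i).pos a
  bends
    | [] => []
    | [i] => be i
    | i :: j :: a => ((Γ i).bends (j :: a)).map (o i + ·)

section assemble

variable {Γ : ℕ → GridDrawing} {o : ℕ → ℤ × ℤ} {be : ℕ → List (ℤ × ℤ)}

theorem isTranslate_assemble (i : ℕ) (a : List ℕ) :
    IsTranslate ((assemble Γ o be).induced (i :: a)) ((Γ i).induced a) (o i) where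
  pos _ := rfl
  bends b j := by
    have : ∃ m c, a ++ (b ++ [j]) = m :: c := by
      cases a <;> cases b <;> simp
    obtain ⟨m, c, e⟩ := this
    simp [induced, assemble, e]

theorem induced_nil (Γ : GridDrawing) : Γ.induced [] = Γ := rfl

theorem edgePoints_induced (Γ : GridDrawing) (a b : List ℕ) (i : ℕ) :
    (Γ.induced a).edgePoints b i = Γ.edgePoints (a ++ b) i := by
  simp [edgePoints, induced]

theorem assemble_edgePoints_nil (i : ℕ) (h : (Γ i).pos [] = 0) :
    (assemble Γ o be).edgePoints [] i = 0 :: (be i ++ [o i]) := by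
  simp [edgePoints, assemble, h]

theorem assemble_edgePoints_cons (i : ℕ) (a : List ℕ) (j : ℕ) :
    (assemble Γ o be).edgePoints (i :: a) j = ((Γ i).edgePoints a j).map (o i + ·) := by
  have := (isTranslate_assemble (Γ := Γ) (o := o) (be := be) i []).edgePoints a j
  rwa [edgePoints_induced, edgePoints_induced] at this

theorem mem_assemble_edgeCurve_cons {i : ℕ} {a : List ℕ} {j : ℕ} {p : ℝ × ℝ} :
    p ∈ (assemble Γ o be).edgeCurve (i :: a) j ↔ p - gridPoint (o i) ∈ (Γ i).edgeCurve a j := by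
  rw [edgeCurve, assemble_edgePoints_cons, polyline_map_add, edgeCurve]

theorem assemble_childDir_cons (i : ℕ) (a : List ℕ) (j : ℕ) :
    (assemble Γ o be).childDir (i :: a) j = (Γ i).childDir a j := by
  have : ∃ m c, a ++ [j] = m :: c := by cases a <;> simp
  obtain ⟨m, c, e⟩ := this
  have key : ∀ (L : List (ℤ × ℤ)) (q x : ℤ × ℤ), (L.map (q + ·) ++ [q + x]).head (by simp) =
      q + (L ++ [x]).head (by simp) := by
    intro L q x
    cases L <;> simp
  simp only [childDir, List.cons_append, e, assemble, key, add_sub_add_left_eq_sub]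

theorem assemble_support {cs : List OrderedTree}
    (hroot : ∀ i S, cs[i]? = some S → (Γ i).pos [] = 0) {p : ℝ × ℝ}
    (hp : p ∈ (assemble Γ o be).support (node cs)) :
    p = 0 ∨ ∃ i S, cs[i]? = some S ∧
      (p ∈ polyline (0 :: (be i ++ [o i])) ∨ p - gridPoint (o i) ∈ (Γ i).support S) := by
  rcases hp with ⟨a, ha, rfl⟩ | ⟨a, j, ha, hp⟩
  · cases a with
    | nil => exact Or.inl gridPoint_zero
    | cons i a =>
      obtain ⟨S, hS, h⟩ := cons_mem_nodes.1 ha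
      refine Or.inr ⟨i, S, hS, Or.inr ?_⟩
      have : gridPoint ((assemble Γ o be).pos (i :: a)) - gridPoint (o i) =
          gridPoint ((Γ i).pos a) := by
        rw [assemble, gridPoint_add, add_sub_cancel_left]
      rw [this]
      exact node_mem_support h
  · right
    cases a with
    | nil =>
      obtain ⟨S, hS, -⟩ := cons_mem_nodes.1 ha
      rw [edgeCurve, assemble_edgePoints_nil j (hroot j S hS)] at hp
      exact ⟨j, S, hS, Or.inl hp⟩
    | cons i a =>
      obtain ⟨S, hS, h⟩ := cons_mem_nodes.1 ha
      exact ⟨i, S, hS, Or.inr (edge_mem_support h (mem_assemble_edgeCurve_cons.1 hp))⟩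

end assemble

/-- The alternatives are the segments before and after the bend; multiplying abscissas by σ treats
both sides at once. -/
theorem mem_bent_edge {σ X y : ℤ} (hσ : σ = 1 ∨ σ = -1) (hX : 2 ≤ σ * X) {p : ℝ × ℝ}
    (hp : p ∈ polyline [0, (σ, y), (X, y - 1)]) :
    (0 ≤ σ * p.1 ∧ σ * p.1 ≤ 1 ∧ p.2 = σ * p.1 * y) ∨
      (1 ≤ σ * p.1 ∧ σ * p.1 ≤ σ * X ∧ y - 1 ≤ p.2 ∧ p.2 ≤ y ∧ (σ * p.1 = 1 → p.2 = y) ∧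
        (p.2 = y - 1 → p = gridPoint (X, y - 1))) := by
  have hσ' : (σ : ℝ) * σ = 1 := by rcases hσ with rfl | rfl <;> norm_num
  have hX' : (2 : ℝ) ≤ σ * X := by exact_mod_cast hX
  have second : ∀ p : ℝ × ℝ, p ∈ segment ℝ (gridPoint (σ, y)) (gridPoint (X, y - 1)) →
      (1 ≤ σ * p.1 ∧ σ * p.1 ≤ σ * X ∧ y - 1 ≤ p.2 ∧ p.2 ≤ y ∧ (σ * p.1 = 1 → p.2 = y) ∧
        (p.2 = y - 1 → p = gridPoint (X, y - 1))) := by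
    intro p hp
    obtain ⟨t, h0, h1, hx, hy⟩ := mem_segment_gridPoint hp
    push_cast at hx hy
    have e : (σ : ℝ) * p.1 = 1 + t * (σ * X - 1) := by rw [hx, mul_add, mul_left_comm, mul_sub, hσ']
    refine ⟨by nlinarith, by nlinarith, by linarith, by linarith, fun h => ?_, fun h => ?_⟩
    · rcases mul_eq_zero.1 (show t * ((σ : ℝ) * X - 1) = 0 by linarith) with h | h
      · rw [hy, h]
        ring
      · linarith
    · have ht : t = 1 := by linarith
      subst ht
      ext <;> simp [gridPoint, hx, hy]
      ring
  rcases hp with hp | hp | hp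
  · left
    obtain ⟨t, h0, h1, hx, hy⟩ := mem_segment_gridPoint hp
    simp only [Prod.fst_zero, Prod.snd_zero, Int.cast_zero, zero_add, sub_zero] at hx hy
    have e : (σ : ℝ) * p.1 = t := by rw [hx, mul_left_comm, hσ', mul_one]
    rw [e]
    exact ⟨h0, h1, hy⟩
  · exact Or.inr (second p hp)
  · rw [show p = gridPoint (X, y - 1) from hp]
    exact Or.inr (second _ (right_mem_segment ℝ _ _))

/-- The root of the `i`-th subtree of a tree whose `k`-th subtree is drawn below all others. -/
def layoutRoot (k : ℕ) (X y : ℕ → ℤ) (Y : ℤ) (i : ℕ) : ℤ × ℤ :=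
  if i = k then (0, Y) else (X i, y i - 1)

/-- The bends of the edge to the `i`-th subtree. -/
def layoutBends (k : ℕ) (σ y : ℕ → ℤ) (i : ℕ) : List (ℤ × ℤ) :=
  if i = k then [] else [(σ i, y i)]

/-- Conditions under which the drawings `Γ i` of the subtrees can be put together: the `k`-th
subtree has its root at `(0, Y)` and lies below all others, which lie in disjoint strips,
to the left and to the right (`σ i`) of the column of the root. -/
structure IsLayout (cs : List OrderedTree) (k : ℕ) (Γ : ℕ → GridDrawing) (σ X y : ℕ → ℤ) (Y : ℤ)
    (A B : ℕ) : Prop where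
  lt_length : k < cs.length
  good : ∀ i S, cs[i]? = some S → ∃ l r, (Γ i).IsGood S l r
  side_left : ∀ i, i < k → σ i = -1
  side_right : ∀ i, k < i → σ i = 1
  box : ∀ i S, cs[i]? = some S → i ≠ k → ∀ p ∈ (Γ i).support S,
    2 ≤ σ i * (X i + p.1) ∧ -(A : ℝ) ≤ X i + p.1 ∧ X i + p.1 ≤ B
  box_low : ∀ S, cs[k]? = some S → ∀ p ∈ (Γ k).support S, -(A : ℝ) ≤ p.1 ∧ p.1 ≤ B
  y_neg : ∀ i, i ≠ k → y i ≤ -1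
  strip_left : ∀ i j S, cs[i]? = some S → i < j → j < k → y j ≤ y i - 2 * S.size
  strip_right : ∀ i j S, cs[j]? = some S → k < i → i < j → y i ≤ y j - 2 * S.size
  Y_neg : Y ≤ -1
  Y_le : ∀ i S, cs[i]? = some S → i ≠ k → Y ≤ y i - 2 * S.size
  le_Y : ∀ S, cs[k]? = some S → 2 * (S.size : ℤ) - 2 * (node cs).size ≤ Y

namespace IsLayout

variable {cs : List OrderedTree} {k : ℕ} {Γ : ℕ → GridDrawing} {σ X y : ℕ → ℤ} {Y : ℤ} {A B : ℕ}
  {i j : ℕ} {S S' : OrderedTree} {p : ℝ × ℝ}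

theorem side (h : IsLayout cs k Γ σ X y Y A B) (hi : i ≠ k) : σ i = 1 ∨ σ i = -1 := by
  rcases lt_or_gt_of_ne hi with hi | hi
  · exact Or.inr (h.side_left i hi)
  · exact Or.inl (h.side_right i hi)

theorem root_eq (h : IsLayout cs k Γ σ X y Y A B) (hS : cs[i]? = some S) : (Γ i).pos [] = 0 := by
  obtain ⟨l, r, hg⟩ := h.good i S hS
  exact hg.root

theorem mem_child (h : IsLayout cs k Γ σ X y Y A B) (hS : cs[i]? = some S) (hi : i ≠ k)
    (hp : p - gridPoint (layoutRoot k X y Y i) ∈ (Γ i).support S) :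
    2 ≤ σ i * p.1 ∧ -(A : ℝ) ≤ p.1 ∧ p.1 ≤ B ∧ y i - 2 * S.size + 1 ≤ p.2 ∧ p.2 ≤ y i - 1 ∧
      (p.2 = y i - 1 → p = gridPoint (layoutRoot k X y Y i)) := by
  obtain ⟨l, r, hg⟩ := h.good i S hS
  have hb := hg.bounds _ hp
  have hx := h.box i S hS hi _ hp
  rw [sub_eq_zero] at hb
  simp only [layoutRoot, hi, if_false, gridPoint, Prod.fst_sub, Prod.snd_sub] at hb hx ⊢
  push_cast at hb hx ⊢
  rw [add_sub_cancel] at hx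
  obtain ⟨-, -, h3, h4, h5⟩ := hb
  exact ⟨hx.1, hx.2.1, hx.2.2, by linarith, by linarith, fun e => h5 (by linarith)⟩

theorem mem_child_low (h : IsLayout cs k Γ σ X y Y A B) (hS : cs[k]? = some S)
    (hp : p - gridPoint (layoutRoot k X y Y k) ∈ (Γ k).support S) :
    -(A : ℝ) ≤ p.1 ∧ p.1 ≤ B ∧ -(2 * (node cs).size - 2 : ℝ) ≤ p.2 ∧ p.2 ≤ Y ∧
      (p.2 = Y → p = gridPoint (layoutRoot k X y Y k)) := by
  obtain ⟨l, r, hg⟩ := h.good k S hS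
  have hb := hg.bounds _ hp
  have hx := h.box_low S hS _ hp
  have hY : 2 * (S.size : ℝ) - 2 * (node cs).size ≤ Y := by exact_mod_cast h.le_Y S hS
  rw [sub_eq_zero] at hb
  simp only [layoutRoot, if_true, gridPoint, Prod.fst_sub, Prod.snd_sub] at hb hx ⊢
  push_cast at hb hx ⊢
  rw [sub_zero] at hx
  obtain ⟨-, -, h3, h4, h5⟩ := hb
  exact ⟨hx.1, hx.2, by linarith, by linarith, fun e => h5 (by linarith)⟩

theorem two_le (h : IsLayout cs k Γ σ X y Y A B) (hS : cs[i]? = some S) (hi : i ≠ k) :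
    2 ≤ σ i * X i ∧ -(A : ℤ) ≤ X i ∧ X i ≤ B := by
  have := h.box i S hS hi _ (node_mem_support (nil_mem_nodes S))
  rw [h.root_eq hS, gridPoint_zero, Prod.fst_zero, add_zero] at this
  exact_mod_cast this

theorem mem_edge (h : IsLayout cs k Γ σ X y Y A B) (hS : cs[i]? = some S) (hi : i ≠ k)
    (hp : p ∈ polyline (0 :: (layoutBends k σ y i ++ [layoutRoot k X y Y i]))) :
    (0 ≤ σ i * p.1 ∧ σ i * p.1 ≤ 1 ∧ p.2 = σ i * p.1 * y i) ∨
      (1 ≤ σ i * p.1 ∧ σ i * p.1 ≤ σ i * X i ∧ y i - 1 ≤ p.2 ∧ p.2 ≤ y i ∧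
        (σ i * p.1 = 1 → p.2 = y i) ∧
        (p.2 = y i - 1 → p = gridPoint (layoutRoot k X y Y i))) := by
  simp only [layoutBends, layoutRoot, hi, if_false] at hp ⊢
  exact mem_bent_edge (h.side hi) (h.two_le hS hi).1 hp

theorem mem_edge_low (h : IsLayout cs k Γ σ X y Y A B)
    (hp : p ∈ polyline (0 :: (layoutBends k σ y k ++ [layoutRoot k X y Y k]))) :
    p.1 = 0 ∧ Y ≤ p.2 ∧ p.2 ≤ 0 := by
  simp only [layoutBends, layoutRoot, if_true, List.nil_append] at hp
  have hY : (Y : ℝ) ≤ -1 := by exact_mod_cast h.Y_neg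
  rcases hp with hp | hp
  · obtain ⟨t, h0, h1, hx, hy⟩ := mem_segment_gridPoint hp
    simp only [Prod.fst_zero, Prod.snd_zero, Int.cast_zero, zero_add, sub_zero, mul_zero] at hx hy
    exact ⟨hx, by nlinarith, by nlinarith⟩
  · rw [show p = gridPoint (0, Y) from hp]
    simp only [gridPoint, Int.cast_zero]
    exact ⟨trivial, le_rfl, by linarith⟩

theorem one_le_size (S : OrderedTree) : (1 : ℝ) ≤ S.size := by exact_mod_cast S.size_pos

theorem y_real (h : IsLayout cs k Γ σ X y Y A B) (hi : i ≠ k) : (y i : ℝ) ≤ -1 := by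
  exact_mod_cast h.y_neg i hi

theorem Y_real (h : IsLayout cs k Γ σ X y Y A B) (hS : cs[i]? = some S) (hi : i ≠ k) :
    (Y : ℝ) ≤ y i - 2 * S.size := by
  exact_mod_cast h.Y_le i S hS hi

/-- Two side subtrees are separated either by the root's column or, on the same side, by their
strips of 2·size rows, the bend row included. -/
theorem side_cases (h : IsLayout cs k Γ σ X y Y A B) (hi : i ≠ k) (hj : j ≠ k) (hij : i ≠ j)
    (hS : cs[i]? = some S) (hS' : cs[j]? = some S') :
    (σ j : ℝ) = -σ i ∨ (σ j : ℝ) = σ i ∧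
      ((y j : ℝ) ≤ y i - 2 * S.size ∨ (y i : ℝ) ≤ y j - 2 * S'.size) := by
  rcases lt_or_gt_of_ne hi with h1 | h1 <;> rcases lt_or_gt_of_ne hj with h2 | h2
  · rw [h.side_left i h1, h.side_left j h2]
    rcases lt_or_gt_of_ne hij with h3 | h3
    · exact Or.inr ⟨rfl, Or.inl (by exact_mod_cast h.strip_left i j S hS h3 h2)⟩
    · exact Or.inr ⟨rfl, Or.inr (by exact_mod_cast h.strip_left j i S' hS' h3 h1)⟩
  · rw [h.side_left i h1, h.side_right j h2]
    norm_num
  · rw [h.side_right i h1, h.side_left j h2]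
    norm_num
  · rw [h.side_right i h1, h.side_right j h2]
    rcases lt_or_gt_of_ne hij with h3 | h3
    · exact Or.inr ⟨rfl, Or.inr (by exact_mod_cast h.strip_right i j S' hS' h1 h3)⟩
    · exact Or.inr ⟨rfl, Or.inl (by exact_mod_cast h.strip_right j i S hS h2 h3)⟩

theorem eq_zero_of_side (h : IsLayout cs k Γ σ X y Y A B) (hi : i ≠ k) (h1 : (σ i : ℝ) * p.1 = 0)
    (h2 : p.2 = 0) : p = 0 := by
  have : (σ i : ℝ) ≠ 0 := by
    rcases h.side hi with e | e <;> rw [e] <;> norm_num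
  ext
  · simpa [this] using h1
  · exact h2

theorem edge_edge_low (h : IsLayout cs k Γ σ X y Y A B) (hS : cs[i]? = some S) (hi : i ≠ k)
    (hp : p ∈ polyline (0 :: (layoutBends k σ y i ++ [layoutRoot k X y Y i])))
    (hp' : p ∈ polyline (0 :: (layoutBends k σ y k ++ [layoutRoot k X y Y k]))) : p = 0 := by
  obtain ⟨h1, -, -⟩ := h.mem_edge_low hp'
  rcases h.mem_edge hS hi hp with ⟨-, -, h2⟩ | ⟨h2, -⟩
  · exact h.eq_zero_of_side hi (by simp [h1]) (by simp [h2, h1])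
  · rw [h1] at h2
    norm_num at h2

/-- On the same side, first segments lie on lines of different slopes through the origin, final
segments lie in different strips, and a first segment can meet a final one only in column ±1, where
the bends have different heights. -/
theorem edge_edge (h : IsLayout cs k Γ σ X y Y A B) (hS : cs[i]? = some S)
    (hS' : cs[j]? = some S') (hij : i ≠ j)
    (hp : p ∈ polyline (0 :: (layoutBends k σ y i ++ [layoutRoot k X y Y i])))
    (hp' : p ∈ polyline (0 :: (layoutBends k σ y j ++ [layoutRoot k X y Y j]))) : p = 0 := by
  by_cases hi : i = k
  · subst hi
    exact h.edge_edge_low hS' hij.symm hp' hp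
  by_cases hj : j = k
  · subst hj
    exact h.edge_edge_low hS hij hp hp'
  have e1 := h.mem_edge hS hi hp
  have e2 := h.mem_edge hS' hj hp'
  have s1 := one_le_size S
  have s2 := one_le_size S'
  rcases h.side_cases hi hj hij hS hS' with hs | ⟨hs, hy⟩ <;> rw [hs] at e2
  · rcases e1 with ⟨a1, a2, a3⟩ | ⟨a1, -⟩ <;> rcases e2 with ⟨b1, b2, b3⟩ | ⟨b1, -⟩ <;>
      try linarith
    have h0 : (σ i : ℝ) * p.1 = 0 := by linarith
    exact h.eq_zero_of_side hi h0 (by rw [a3, h0, zero_mul])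
  · have hne : (y i : ℝ) - y j ≠ 0 := by
      rcases hy with hy | hy
      · exact ne_of_gt (by linarith)
      · exact ne_of_lt (by linarith)
    rcases e1 with ⟨a1, a2, a3⟩ | ⟨a1, -, a2, a3, a4, -⟩ <;>
      rcases e2 with ⟨b1, b2, b3⟩ | ⟨b1, -, b2, b3, b4, -⟩
    · rcases mul_eq_zero.1 (show ((σ i : ℝ) * p.1) * (y i - y j) = 0 by linarith) with h0 | h0
      · exact h.eq_zero_of_side hi h0 (by rw [a3, h0, zero_mul])
      · exact absurd h0 hne
    · have h1 : (σ i : ℝ) * p.1 = 1 := by linarith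
      have := b4 h1
      rw [h1] at a3
      exact absurd (by linarith) hne
    · have h1 : (σ i : ℝ) * p.1 = 1 := by linarith
      have := a4 h1
      rw [h1] at b3
      exact absurd (by linarith) hne
    · rcases hy with hy | hy <;> linarith

theorem child_child_low (h : IsLayout cs k Γ σ X y Y A B) (hS : cs[i]? = some S)
    (hS' : cs[k]? = some S') (hi : i ≠ k)
    (hp : p - gridPoint (layoutRoot k X y Y i) ∈ (Γ i).support S)
    (hp' : p - gridPoint (layoutRoot k X y Y k) ∈ (Γ k).support S') : False := by
  obtain ⟨-, -, -, h1, -⟩ := h.mem_child hS hi hp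
  obtain ⟨-, -, -, h2, -⟩ := h.mem_child_low hS' hp'
  linarith [h.Y_real hS hi]

theorem child_child (h : IsLayout cs k Γ σ X y Y A B) (hS : cs[i]? = some S)
    (hS' : cs[j]? = some S') (hij : i ≠ j)
    (hp : p - gridPoint (layoutRoot k X y Y i) ∈ (Γ i).support S)
    (hp' : p - gridPoint (layoutRoot k X y Y j) ∈ (Γ j).support S') : False := by
  by_cases hi : i = k
  · subst hi
    exact h.child_child_low hS' hS hij.symm hp' hp
  by_cases hj : j = k
  · subst hj
    exact h.child_child_low hS hS' hij hp hp'
  obtain ⟨a1, -, -, a2, a3, -⟩ := h.mem_child hS hi hp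
  obtain ⟨b1, -, -, b2, b3, -⟩ := h.mem_child hS' hj hp'
  rcases h.side_cases hi hj hij hS hS' with hs | ⟨hs, hy | hy⟩ <;> rw [hs] at b1 <;> linarith

/-- First segments stay within columns −1 to 1, which side subtrees avoid; final segments stay in
their own strip; the subtree on the path lies below all of this. -/
theorem edge_child (h : IsLayout cs k Γ σ X y Y A B) (hS : cs[i]? = some S)
    (hS' : cs[j]? = some S') (hij : i ≠ j)
    (hp : p ∈ polyline (0 :: (layoutBends k σ y i ++ [layoutRoot k X y Y i])))
    (hp' : p - gridPoint (layoutRoot k X y Y j) ∈ (Γ j).support S') : False := by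
  have s1 := one_le_size S
  have s2 := one_le_size S'
  by_cases hi : i = k
  · subst hi
    obtain ⟨a, -⟩ := h.mem_child hS' hij.symm hp'
    rw [(h.mem_edge_low hp).1] at a
    norm_num at a
  by_cases hj : j = k
  · subst hj
    obtain ⟨-, -, -, b, -⟩ := h.mem_child_low hS' hp'
    have hY := h.Y_real hS hij
    have hy := h.y_real hij
    rcases h.mem_edge hS hi hp with ⟨a1, a2, a3⟩ | ⟨-, -, a, -⟩
    · nlinarith
    · linarith
  obtain ⟨b1, -, -, b2, b3, -⟩ := h.mem_child hS' hj hp'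
  rcases h.mem_edge hS hi hp with ⟨a1, a2, a3⟩ | ⟨a1, -, a2, a3, -⟩ <;>
    rcases h.side_cases hi hj hij hS hS' with hs | ⟨hs, hy | hy⟩ <;> rw [hs] at b1 <;> linarith

/-- The edge does not go below the top row of the subtree, and the root is the subtree's only point
in that row. -/
theorem edge_own_child (h : IsLayout cs k Γ σ X y Y A B) (hS : cs[i]? = some S)
    (hp : p ∈ polyline (0 :: (layoutBends k σ y i ++ [layoutRoot k X y Y i])))
    (hp' : p - gridPoint (layoutRoot k X y Y i) ∈ (Γ i).support S) :
    p = gridPoint (layoutRoot k X y Y i) := by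
  by_cases hi : i = k
  · subst hi
    obtain ⟨-, -, -, b1, b2⟩ := h.mem_child_low hS hp'
    exact b2 (le_antisymm b1 (h.mem_edge_low hp).2.1)
  · obtain ⟨b1, -, -, b2, b3, b4⟩ := h.mem_child hS hi hp'
    rcases h.mem_edge hS hi hp with ⟨a1, a2, a3⟩ | ⟨a1, -, a2, a3, -⟩
    · linarith
    · exact b4 (by linarith)

theorem ne_zero_of_mem_child (h : IsLayout cs k Γ σ X y Y A B) (hS : cs[i]? = some S)
    (hp : p - gridPoint (layoutRoot k X y Y i) ∈ (Γ i).support S) : p ≠ 0 := by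
  rintro rfl
  by_cases hi : i = k
  · subst hi
    have := (h.mem_child_low hS hp).2.2.2.1
    have hY : (Y : ℝ) ≤ -1 := by exact_mod_cast h.Y_neg
    simp only [Prod.snd_zero] at this
    linarith
  · have := (h.mem_child hS hi hp).2.2.2.2.1
    simp only [Prod.snd_zero] at this
    linarith [h.y_real hi]

end IsLayout

end GridDrawing

-- Correctness of the assembled drawing

namespace GridDrawing

namespace IsLayout

variable {cs : List OrderedTree} {k : ℕ} {Γ : ℕ → GridDrawing} {σ X y : ℕ → ℤ} {Y : ℤ} {A B : ℕ}
  {i j : ℕ} {S S' : OrderedTree} {p : ℝ × ℝ}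

/-- The drawing that is put together according to a layout. -/
def drawing (_ : IsLayout cs k Γ σ X y Y A B) : GridDrawing :=
  assemble Γ (layoutRoot k X y Y) (layoutBends k σ y)

theorem pos_sub_mem {a : List ℕ} (ha : a ∈ S.nodes) :
    gridPoint (layoutRoot k X y Y i + (Γ i).pos a) - gridPoint (layoutRoot k X y Y i) ∈
      (Γ i).support S := by
  rw [gridPoint_add, add_sub_cancel_left]
  exact node_mem_support ha

variable (h : IsLayout cs k Γ σ X y Y A B)

theorem edgeCurve_nil (hS : cs[i]? = some S) : h.drawing.edgeCurve [] i =
    polyline (0 :: (layoutBends k σ y i ++ [layoutRoot k X y Y i])) := by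
  rw [drawing, edgeCurve, assemble_edgePoints_nil i (h.root_eq hS)]

theorem edgeCurve_cons {a : List ℕ} : p ∈ h.drawing.edgeCurve (i :: a) j ↔
    p - gridPoint (layoutRoot k X y Y i) ∈ (Γ i).edgeCurve a j :=
  mem_assemble_edgeCurve_cons

theorem pos_cons {a : List ℕ} : h.drawing.pos (i :: a) = layoutRoot k X y Y i + (Γ i).pos a := rfl

theorem pos_nil : h.drawing.pos [] = 0 := rfl

theorem injOn : Set.InjOn h.drawing.pos (node cs).nodes := by
  intro a ha b hb hab
  rcases a with _ | ⟨i, a⟩ <;> rcases b with _ | ⟨j, b⟩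
  · rfl
  · obtain ⟨S, hS, hb⟩ := cons_mem_nodes.1 hb
    refine (h.ne_zero_of_mem_child hS (pos_sub_mem hb) ?_).elim
    rw [← h.pos_cons, ← hab, pos_nil, gridPoint_zero]
  · obtain ⟨S, hS, ha⟩ := cons_mem_nodes.1 ha
    refine (h.ne_zero_of_mem_child hS (pos_sub_mem ha) ?_).elim
    rw [← h.pos_cons, hab, pos_nil, gridPoint_zero]
  · obtain ⟨S, hS, ha⟩ := cons_mem_nodes.1 ha
    obtain ⟨S', hS', hb⟩ := cons_mem_nodes.1 hb
    rw [pos_cons, pos_cons] at hab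
    by_cases hij : i = j
    · subst hij
      obtain rfl : S = S' := by simpa [hS] using hS'
      obtain ⟨l, r, hg⟩ := h.good i S hS
      rw [hg.injective ha hb (add_left_cancel hab)]
    · exact (h.child_child hS hS' hij (pos_sub_mem ha) (hab ▸ pos_sub_mem hb)).elim

theorem node_edge (c : List ℕ) (hc : c ∈ (node cs).nodes) (a : List ℕ) (i : ℕ)
    (ha : a ++ [i] ∈ (node cs).nodes) (hp : gridPoint (h.drawing.pos c) ∈ h.drawing.edgeCurve a i) :
    c = a ∨ c = a ++ [i] := by
  rcases a with _ | ⟨j, a⟩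
  · obtain ⟨S, hS, -⟩ := cons_mem_nodes.1 ha
    rw [h.edgeCurve_nil hS] at hp
    rcases c with _ | ⟨m, c⟩
    · exact Or.inl rfl
    obtain ⟨S', hS', hc⟩ := cons_mem_nodes.1 hc
    rw [pos_cons] at hp
    by_cases him : i = m
    · subst him
      obtain rfl : S = S' := by simpa [hS] using hS'
      have := gridPoint_injective (h.edge_own_child hS hp (pos_sub_mem hc))
      obtain ⟨l, r, hg⟩ := h.good i S hS
      rw [add_eq_left, ← hg.root] at this
      rw [hg.injective hc (nil_mem_nodes S) this]
      exact Or.inr rfl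
    · exact (h.edge_child hS hS' him hp (pos_sub_mem hc)).elim
  · obtain ⟨S, hS, ha⟩ := cons_mem_nodes.1 ha
    rw [h.edgeCurve_cons] at hp
    rcases c with _ | ⟨m, c⟩
    · exact (h.ne_zero_of_mem_child hS (edge_mem_support ha hp)
        (by rw [pos_nil, gridPoint_zero])).elim
    obtain ⟨S', hS', hc⟩ := cons_mem_nodes.1 hc
    rw [pos_cons] at hp
    by_cases hjm : j = m
    · subst hjm
      obtain rfl : S = S' := by simpa [hS] using hS'
      obtain ⟨l, r, hg⟩ := h.good j S hS
      rw [gridPoint_add, add_sub_cancel_left] at hp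
      rcases hg.node_edge c hc a i ha hp with rfl | rfl
      · exact Or.inl rfl
      · exact Or.inr rfl
    · exact (h.child_child hS hS' hjm (edge_mem_support ha hp) (pos_sub_mem hc)).elim

theorem root_edge_edge (hS : cs[i]? = some S) {b : List ℕ} {m : ℕ}
    (hb : j :: b ++ [m] ∈ (node cs).nodes) (hp : p ∈ h.drawing.edgeCurve [] i)
    (hp' : p ∈ h.drawing.edgeCurve (j :: b) m) :
    j = i ∧ b = [] ∧ p = gridPoint (h.drawing.pos [i]) := by
  obtain ⟨S', hS', hb⟩ := cons_mem_nodes.1 hb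
  rw [h.edgeCurve_nil hS] at hp
  rw [h.edgeCurve_cons] at hp'
  by_cases hij : i = j
  · subst hij
    obtain rfl : S = S' := by simpa [hS] using hS'
    obtain ⟨l, r, hg⟩ := h.good i S hS
    have e := h.edge_own_child hS hp (edge_mem_support hb hp')
    -- The common point is the subtree's root, so `node_edge` inside the subtree forces the second
    -- edge to start there.
    rw [e, sub_self, ← gridPoint_zero, ← hg.root] at hp'
    refine ⟨rfl, ?_, ?_⟩
    · rcases hg.node_edge [] (nil_mem_nodes S) b m hb hp' with h | h
      · exact h.symm
      · simp at h
    · rw [e, pos_cons, hg.root, add_zero]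
  · exact (h.edge_child hS hS' hij hp (edge_mem_support hb hp')).elim

theorem edge_edge_drawing (a : List ℕ) (i : ℕ) (b : List ℕ) (j : ℕ)
    (ha : a ++ [i] ∈ (node cs).nodes) (hb : b ++ [j] ∈ (node cs).nodes) (hne : (a, i) ≠ (b, j))
    (p : ℝ × ℝ) (hp : p ∈ h.drawing.edgeCurve a i) (hp' : p ∈ h.drawing.edgeCurve b j) :
    ∃ c, (c = a ∨ c = a ++ [i]) ∧ (c = b ∨ c = b ++ [j]) ∧ p = gridPoint (h.drawing.pos c) := by
  rcases a with _ | ⟨m, a⟩ <;> rcases b with _ | ⟨n, b⟩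
  · obtain ⟨S, hS, -⟩ := cons_mem_nodes.1 ha
    obtain ⟨S', hS', -⟩ := cons_mem_nodes.1 hb
    rw [h.edgeCurve_nil hS] at hp
    rw [h.edgeCurve_nil hS'] at hp'
    refine ⟨[], Or.inl rfl, Or.inl rfl, ?_⟩
    rw [h.edge_edge hS hS' (by simpa using hne) hp hp', pos_nil, gridPoint_zero]
  · obtain ⟨S, hS, -⟩ := cons_mem_nodes.1 ha
    obtain ⟨rfl, rfl, e⟩ := h.root_edge_edge hS hb hp hp'
    exact ⟨[n], Or.inr rfl, Or.inl rfl, e⟩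
  · obtain ⟨S, hS, -⟩ := cons_mem_nodes.1 hb
    obtain ⟨rfl, rfl, e⟩ := h.root_edge_edge hS ha hp' hp
    exact ⟨[m], Or.inl rfl, Or.inr rfl, e⟩
  · obtain ⟨S, hS, ha⟩ := cons_mem_nodes.1 ha
    obtain ⟨S', hS', hb⟩ := cons_mem_nodes.1 hb
    rw [h.edgeCurve_cons] at hp hp'
    by_cases hmn : m = n
    · subst hmn
      obtain rfl : S = S' := by simpa [hS] using hS'
      obtain ⟨l, r, hg⟩ := h.good m S hS
      obtain ⟨c, h1, h2, h3⟩ := hg.edge_edge a i b j ha hb (by simpa using hne) _ hp hp'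
      refine ⟨m :: c, by simpa using h1, by simpa using h2, ?_⟩
      rw [pos_cons, gridPoint_add, ← h3, add_sub_cancel]
    · exact (h.child_child hS hS' hmn (edge_mem_support ha hp) (edge_mem_support hb hp')).elim

theorem edge_monotone (a : List ℕ) (i : ℕ) (ha : a ++ [i] ∈ (node cs).nodes) :
    (h.drawing.edgePoints a i).Pairwise (fun p q => q.2 < p.2) := by
  rcases a with _ | ⟨j, a⟩
  · obtain ⟨S, hS, -⟩ := cons_mem_nodes.1 ha
    rw [drawing, assemble_edgePoints_nil i (h.root_eq hS)]
    by_cases hi : i = k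
    · have := h.Y_neg
      simp [layoutBends, layoutRoot, hi]
      omega
    · have := h.y_neg i hi
      simp [layoutBends, layoutRoot, hi]
      omega
  · obtain ⟨S, hS, ha⟩ := cons_mem_nodes.1 ha
    obtain ⟨l, r, hg⟩ := h.good j S hS
    rw [drawing, assemble_edgePoints_cons, List.pairwise_map]
    simpa using hg.edge_monotone a i ha

theorem bends_length (a : List ℕ) (i : ℕ) (ha : a ++ [i] ∈ (node cs).nodes) :
    (h.drawing.bends (a ++ [i])).length ≤ 1 := by
  rcases a with _ | ⟨j, a⟩
  · change (layoutBends k σ y i).length ≤ 1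
    unfold layoutBends
    split_ifs <;> simp
  · obtain ⟨S, hS, ha⟩ := cons_mem_nodes.1 ha
    obtain ⟨l, r, hg⟩ := h.good j S hS
    have := (isTranslate_assemble (Γ := Γ) (o := layoutRoot k X y Y) (be := layoutBends k σ y) j
      []).bends a i
    change h.drawing.bends (j :: (a ++ [i])) = ((Γ j).bends (a ++ [i])).map _ at this
    rw [List.cons_append, this, List.length_map]
    exact hg.bends_length a i ha

theorem childDir_nil (hS : cs[i]? = some S) : h.drawing.childDir [] i =
    if i = k then (0, Y) else (σ i, y i) := by
  by_cases hi : i = k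
  · subst hi
    simp [childDir, drawing, assemble, layoutBends, layoutRoot, h.root_eq hS]
  · simp [childDir, drawing, assemble, layoutBends, hi]

/-- All bends at the root lie in columns ±1, so the angular order is that of the heights: strips
descend towards the path on both sides. -/
theorem cross_pos (a : List ℕ) (i j : ℕ) (hij : i < j) (hi : a ++ [i] ∈ (node cs).nodes)
    (hj : a ++ [j] ∈ (node cs).nodes) :
    0 < cross (h.drawing.childDir a i) (h.drawing.childDir a j) := by
  rcases a with _ | ⟨m, a⟩
  · obtain ⟨S, hS, -⟩ := cons_mem_nodes.1 hi
    obtain ⟨S', hS', -⟩ := cons_mem_nodes.1 hj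
    rw [h.childDir_nil hS, h.childDir_nil hS', cross]
    have hY := h.Y_neg
    have s1 := S.size_pos
    have s2 := S'.size_pos
    rcases lt_trichotomy i k with h1 | rfl | h1
    · have y1 := h.y_neg i h1.ne
      rcases lt_trichotomy j k with h2 | rfl | h2
      · have := h.strip_left i j S hS hij h2
        simp only [h1.ne, h2.ne, if_false, h.side_left i h1, h.side_left j h2]
        omega
      · simp only [h1.ne, if_true, if_false, h.side_left i h1]
        omega
      · have y2 := h.y_neg j h2.ne'
        simp only [h1.ne, h2.ne', if_false, h.side_left i h1, h.side_right j h2]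
        omega
    · simp only [hij.ne', if_true, if_false, h.side_right j hij]
      omega
    · have h2 := h1.trans hij
      have := h.strip_right i j S' hS' h1 hij
      simp only [h1.ne', h2.ne', if_false, h.side_right i h1, h.side_right j h2]
      omega
  · obtain ⟨S, hS, hi⟩ := cons_mem_nodes.1 hi
    obtain ⟨S', hS', hj⟩ := cons_mem_nodes.1 hj
    obtain rfl : S = S' := by simpa [hS] using hS'
    obtain ⟨l, r, hg⟩ := h.good m S hS
    rw [drawing, assemble_childDir_cons, assemble_childDir_cons]
    exact hg.cross_pos a i j hij hi hj

theorem mem_support_induced : p ∈ (h.drawing.induced [i]).support S ↔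
    p - gridPoint (layoutRoot k X y Y i) ∈ (Γ i).support S :=
  (isTranslate_assemble i []).mem_support

/-- The vertical path of the `k`-th subtree, which starts at its root in column 0, is prolonged by
the root. -/
theorem separatingPath_root : ∃ π x, h.drawing.IsSeparatingPath (node cs) π x := by
  obtain ⟨C, hC⟩ : ∃ C, cs[k]? = some C := ⟨_, List.getElem?_eq_getElem h.lt_length⟩
  obtain ⟨l, r, hg⟩ := h.good k C hC
  obtain ⟨π, x, hπ⟩ := hg.separatingPath [] C (by rw [subtreeAt])
  obtain rfl : x = 0 := by
    have := hπ.node_aligned [] List.nil_prefix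
    rw [induced_nil, hg.root] at this
    exact this.symm
  have hπ' := (isTranslate_assemble (Γ := Γ) (o := layoutRoot k X y Y) (be := layoutBends k σ y) k
      []).isSeparatingPath hπ
  have ho : (layoutRoot k X y Y k).1 = 0 := by simp [layoutRoot]
  rw [ho, add_zero] at hπ'
  change (h.drawing.induced [k]).IsSeparatingPath C π 0 at hπ'
  refine ⟨k :: π, 0, (subtreeAt_cons _ _ _ _).2 ⟨C, hC, hπ.isLeaf⟩, ?_, ?_, ?_, ?_, ?_⟩
  · intro a ha
    rcases a with _ | ⟨j, a⟩
    · rfl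
    · obtain ⟨rfl, ha'⟩ := List.cons_prefix_cons.1 ha
      exact hπ'.node_aligned a ha'
  · intro a j ha p hp
    rcases a with _ | ⟨m, a⟩
    · obtain ⟨rfl, -⟩ := List.cons_prefix_cons.1 ha
      rw [h.edgeCurve_nil hC] at hp
      simpa using (h.mem_edge_low hp).1
    · obtain ⟨rfl, ha'⟩ := List.cons_prefix_cons.1 ha
      refine hπ'.edge_vertical a j ha' p ?_
      rwa [edgeCurve, edgePoints_induced]
  · intro a j ha
    rcases a with _ | ⟨m, a⟩
    · obtain ⟨rfl, -⟩ := List.cons_prefix_cons.1 ha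
      have := h.Y_neg
      change (layoutRoot j X y Y j + (Γ j).pos []).2 < 0
      rw [hg.root]
      simp [layoutRoot]
      omega
    · obtain ⟨rfl, ha'⟩ := List.cons_prefix_cons.1 ha
      exact hπ'.above a j ha'
  · intro a j i S ha hi hS p hp
    rcases a with _ | ⟨m, a⟩
    · obtain ⟨rfl, -⟩ := List.cons_prefix_cons.1 ha
      obtain ⟨R, hR, e⟩ := (subtreeAt_cons _ _ _ _).1 hS
      rw [subtreeAt, Option.some_inj] at e
      subst e
      have := (h.mem_child hR hi.ne (h.mem_support_induced.1 hp)).1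
      rw [h.side_left i hi] at this
      push_cast at this ⊢
      linarith
    · obtain ⟨rfl, ha'⟩ := List.cons_prefix_cons.1 ha
      obtain ⟨R, hR, e⟩ := (subtreeAt_cons _ _ _ _).1 hS
      obtain rfl : C = R := by simpa [hC] using hR
      exact hπ'.left a j i S ha' hi e p hp
  · intro a j i S ha hi hS p hp
    rcases a with _ | ⟨m, a⟩
    · obtain ⟨rfl, -⟩ := List.cons_prefix_cons.1 ha
      obtain ⟨R, hR, e⟩ := (subtreeAt_cons _ _ _ _).1 hS
      rw [subtreeAt, Option.some_inj] at e
      subst e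
      have := (h.mem_child hR hi.ne' (h.mem_support_induced.1 hp)).1
      rw [h.side_right i hi] at this
      push_cast at this ⊢
      linarith
    · obtain ⟨rfl, ha'⟩ := List.cons_prefix_cons.1 ha
      obtain ⟨R, hR, e⟩ := (subtreeAt_cons _ _ _ _).1 hS
      obtain rfl : C = R := by simpa [hC] using hR
      exact hπ'.right a j i S ha' hi e p hp

theorem separatingPath (a : List ℕ) (S : OrderedTree) (hS : (node cs).subtreeAt a = some S) :
    ∃ π x, (h.drawing.induced a).IsSeparatingPath S π x := by
  rcases a with _ | ⟨i, a⟩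
  · rw [subtreeAt, Option.some_inj] at hS
    subst hS
    exact h.separatingPath_root
  · obtain ⟨R, hR, e⟩ := (subtreeAt_cons _ _ _ _).1 hS
    obtain ⟨l, r, hg⟩ := h.good i R hR
    obtain ⟨π, x, hπ⟩ := hg.separatingPath a S e
    exact ⟨π, _, (isTranslate_assemble i a).isSeparatingPath hπ⟩

theorem bounds (p : ℝ × ℝ) (hp : p ∈ h.drawing.support (node cs)) :
    -(A : ℝ) ≤ p.1 ∧ p.1 ≤ B ∧ -(2 * (node cs).size - 2 : ℝ) ≤ p.2 ∧ p.2 ≤ 0 ∧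
      (p.2 = 0 → p = 0) := by
  obtain ⟨C, hC⟩ : ∃ C, cs[k]? = some C := ⟨_, List.getElem?_eq_getElem h.lt_length⟩
  have hY := h.Y_neg
  have hY' : (Y : ℝ) ≤ -1 := by exact_mod_cast hY
  have hn : 2 * (C.size : ℝ) - 2 * (node cs).size ≤ Y := by exact_mod_cast h.le_Y C hC
  have hsize := IsLayout.one_le_size C
  have hA : (0 : ℝ) ≤ A := by positivity
  have hB : (0 : ℝ) ≤ B := by positivity
  rcases assemble_support (fun i S hS => h.root_eq hS) hp with rfl | ⟨i, S, hS, hp | hp⟩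
  · simp only [Prod.fst_zero, Prod.snd_zero]
    exact ⟨by linarith, hB, by linarith, le_rfl, fun _ => trivial⟩
  · by_cases hi : i = k
    · subst hi
      obtain ⟨h1, h2, h3⟩ := h.mem_edge_low hp
      exact ⟨by linarith, by linarith, by linarith, h3, fun h4 => by ext <;> simp [h1, h4]⟩
    · have hyi := h.y_real hi
      have hYi := h.Y_real hS hi
      have hs := IsLayout.one_le_size S
      obtain ⟨hX, hX1, hX2⟩ := h.two_le hS hi
      have hX1' : -(A : ℝ) ≤ X i := by exact_mod_cast hX1
      have hX2' : (X i : ℝ) ≤ B := by exact_mod_cast hX2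
      have hX' : (2 : ℝ) ≤ σ i * X i := by exact_mod_cast hX
      rcases h.mem_edge hS hi hp with ⟨h1, h2, h3⟩ | ⟨h1, h2, h3, h4, -, -⟩
      · refine ⟨?_, ?_, by nlinarith, by nlinarith, fun h4 => ?_⟩
        · rcases h.side hi with e | e <;> rw [e] at h1 h2 hX' <;> push_cast at h1 h2 hX' <;>
            linarith
        · rcases h.side hi with e | e <;> rw [e] at h1 h2 hX' <;> push_cast at h1 h2 hX' <;>
            linarith
        · rcases mul_eq_zero.1 (h3.symm.trans h4) with h0 | h0
          · exact h.eq_zero_of_side hi h0 h4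
          · linarith
      · refine ⟨?_, ?_, by linarith, by linarith, fun h5 => by linarith⟩
        · rcases h.side hi with e | e <;> rw [e] at h1 h2 hX' <;> push_cast at h1 h2 hX' <;>
            linarith
        · rcases h.side hi with e | e <;> rw [e] at h1 h2 hX' <;> push_cast at h1 h2 hX' <;>
            linarith
  · by_cases hi : i = k
    · subst hi
      obtain ⟨h1, h2, h3, h4, -⟩ := h.mem_child_low hS hp
      exact ⟨h1, h2, h3, by linarith, fun h5 => by linarith⟩
    · have hyi := h.y_real hi
      have hYi := h.Y_real hS hi
      obtain ⟨-, h1, h2, h3, h4, -⟩ := h.mem_child hS hi hp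
      exact ⟨h1, h2, by linarith, by linarith, fun h5 => by linarith⟩

theorem isGood : h.drawing.IsGood (node cs) A B where
  root := rfl
  injective := h.injOn
  node_edge := h.node_edge
  edge_edge := h.edge_edge_drawing
  edge_monotone := h.edge_monotone
  bends_length := h.bends_length
  cross_pos := h.cross_pos
  separatingPath := h.separatingPath
  bounds := h.bounds

end IsLayout

end GridDrawing

-- The layout and the width recursion

namespace OrderedTree

/-- The total size of the first `i` trees of a list. -/
def prefixSize (cs : List OrderedTree) (i : ℕ) : ℕ := ((cs.take i).map size).sum

theorem prefixSize_succ {cs : List OrderedTree} {i : ℕ} {S : OrderedTree} (h : cs[i]? = some S) :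
    prefixSize cs (i + 1) = prefixSize cs i + S.size := by
  simp [prefixSize, List.take_add_one, h]

theorem prefixSize_mono (cs : List OrderedTree) : Monotone (prefixSize cs) := by
  refine monotone_nat_of_le_succ fun i => ?_
  cases h : cs[i]? with
  | none => simp [prefixSize, List.take_add_one, h]
  | some S => rw [prefixSize_succ h]; omega

theorem prefixSize_le (cs : List OrderedTree) (i : ℕ) : prefixSize cs i ≤ (cs.map size).sum := by
  rcases le_total i cs.length with h | h
  · have := prefixSize_mono cs h
    simpa [prefixSize] using this
  · simp [prefixSize, List.take_of_length_le h]

end OrderedTree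

namespace GridDrawing

theorem exists_isGood_node {cs : List OrderedTree} {k A B : ℕ} {C : OrderedTree}
    (hC : cs[k]? = some C) (hlow : ∃ Γ, IsGood Γ C A B)
    (hleft : ∀ i S, cs[i]? = some S → i < k → ∃ Γ l r, IsGood Γ S l r ∧ l + r + 2 ≤ A)
    (hright : ∀ i S, cs[i]? = some S → k < i → ∃ Γ l r, IsGood Γ S l r ∧ l + r + 2 ≤ B) :
    ∃ Γ, IsGood Γ (node cs) A B := by
  have hall : ∀ i, ∃ Γ l r, ∀ S, cs[i]? = some S → IsGood Γ S l r ∧ (i < k → l + r + 2 ≤ A) ∧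
      (k < i → l + r + 2 ≤ B) ∧ (i = k → l = A ∧ r = B) := by
    intro i
    cases hS : cs[i]? with
    -- Dummy value where there is no child.
    | none => exact ⟨⟨fun _ => 0, fun _ => []⟩, 0, 0, by simp⟩
    | some S =>
      rcases lt_trichotomy i k with h | rfl | h
      · obtain ⟨Γ, l, r, hg, hA⟩ := hleft i S hS h
        refine ⟨Γ, l, r, fun S' e => ?_⟩
        rw [← Option.some_inj.1 e]
        exact ⟨hg, fun _ => hA, fun _ => by omega, fun _ => by omega⟩
      · obtain ⟨Γ, hg⟩ := hlow
        refine ⟨Γ, A, B, fun S' e => ?_⟩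
        rw [← Option.some_inj.1 e, ← Option.some_inj.1 (hC.symm.trans hS)]
        exact ⟨hg, fun _ => by omega, fun _ => by omega, fun _ => ⟨rfl, rfl⟩⟩
      · obtain ⟨Γ, l, r, hg, hB⟩ := hright i S hS h
        refine ⟨Γ, l, r, fun S' e => ?_⟩
        rw [← Option.some_inj.1 e]
        exact ⟨hg, fun _ => by omega, fun _ => hB, fun _ => by omega⟩
  choose Γ l r hΓ using hall
  have hmono : ∀ i j S, cs[i]? = some S → i < j → prefixSize cs i + S.size ≤ prefixSize cs j :=
    fun i j S hS hij => prefixSize_succ hS ▸ prefixSize_mono cs hij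
  have hN := prefixSize_le cs
  have hCk := prefixSize_succ hC
  have hsize := size_node cs
  set P := prefixSize cs with hP
  set N := (cs.map size).sum with hN'
  have hpos : ∀ S : OrderedTree, 0 < S.size := size_pos
  -- A side subtree starts in column ±2, as column ±1 is kept for bends; hence the demand l + r + 2.
  -- Left strips are stacked downward in order, right strips in reverse order, and `Y` lies below
  -- the rows needed by all siblings together.
  refine ⟨_, IsLayout.isGood (k := k) (Γ := Γ) (σ := fun i => if i < k then -1 else 1)
    (X := fun i => if i < k then -(2 + (r i : ℤ)) else 2 + l i)
    (y := fun i => if i < k then -1 - 2 * (P i : ℤ) else -1 - 2 * ((N : ℤ) - P (i + 1)))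
    (Y := -1 - 2 * ((N : ℤ) - C.size)) ⟨?_, ?_, ?_, ?_, ?_, ?_, ?_, ?_, ?_, ?_, ?_, ?_⟩⟩
  · exact (List.getElem?_eq_some_iff.1 hC).1
  · exact fun i S hS => ⟨_, _, (hΓ i S hS).1⟩
  · intro i hi
    simp [hi]
  · intro i hi
    simp [hi.not_gt]
  · intro i S hS hi p hp
    obtain ⟨hg, hA, hB, -⟩ := hΓ i S hS
    obtain ⟨h1, h2, -⟩ := hg.bounds p hp
    rcases lt_or_gt_of_ne hi with h | h
    · have hA' : (l i : ℝ) + r i + 2 ≤ A := by exact_mod_cast hA h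
      simp only [h, if_true]
      push_cast
      exact ⟨by linarith, by linarith, by linarith [(Nat.cast_nonneg B : (0 : ℝ) ≤ B)]⟩
    · have hB' : (l i : ℝ) + r i + 2 ≤ B := by exact_mod_cast hB h
      simp only [h.not_gt, if_false]
      push_cast
      exact ⟨by linarith, by linarith [(Nat.cast_nonneg A : (0 : ℝ) ≤ A)], by linarith⟩
  · intro S hS p hp
    obtain ⟨hg, -, -, hk⟩ := hΓ k S hS
    obtain ⟨h1, h2, -⟩ := hg.bounds p hp
    rw [(hk rfl).1] at h1
    rw [(hk rfl).2] at h2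
    exact ⟨h1, h2⟩
  · intro i hi
    have := hN (i + 1)
    split_ifs <;> omega
  · intro i j S hS hij hj
    have := hmono i j S hS hij
    simp only [hij.trans hj, hj, if_true]
    omega
  · intro i j S hS hi hij
    have h1 := prefixSize_succ hS
    have h2 := prefixSize_mono cs (Nat.succ_le_of_lt hij)
    rw [← hP] at h1 h2
    simp only [hi.not_gt, (hi.trans hij).not_gt, if_false]
    simp only [Nat.succ_eq_add_one] at h2
    omega
  · have := hN (k + 1)
    omega
  · intro i S hS hi
    have h1 := prefixSize_succ hS
    have h2 := hN (k + 1)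
    rw [← hP] at h1
    rcases lt_or_gt_of_ne hi with h | h
    · have := hmono i k S hS h
      simp only [h, if_true]
      omega
    · have := hmono k i C hC h
      simp only [h.not_gt, if_false]
      omega
  · intro S hS
    obtain rfl : C = S := Option.some_inj.1 (hC.symm.trans hS)
    omega

/-- Induction along the path with A and B unchanged: the subtree hanging below reuses the same
columns. -/
theorem exists_isGood_of_hasPath {T : OrderedTree} {a b A B : ℕ} (hT : HasPath a b T)
    (ha : ∀ S : OrderedTree, S.size ≤ a → ∃ Γ l r, IsGood Γ S l r ∧ l + r + 2 ≤ A)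
    (hb : ∀ S : OrderedTree, S.size ≤ b → ∃ Γ l r, IsGood Γ S l r ∧ l + r + 2 ≤ B) :
    ∃ Γ, IsGood Γ T A B := by
  induction hT with
  | leaf => exact ⟨_, isGood_leaf A B⟩
  | step xs c ys left right _ ih =>
    refine exists_isGood_node (k := xs.length) (by simp) ih ?_ ?_
    · intro i S hS hi
      rw [List.getElem?_append_left hi] at hS
      exact ha S (left S (List.mem_of_getElem? hS))
    · intro i S hS hi
      obtain ⟨j, rfl⟩ := Nat.exists_eq_add_of_lt hi
      rw [List.getElem?_append_right (by omega),
        show xs.length + j + 1 - xs.length = j + 1 by omega, List.getElem?_cons_succ] at hS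
      exact hb S (right S (List.mem_of_getElem? hS))

theorem exists_isGood (T : OrderedTree) : ∃ Γ l r, IsGood Γ T l r ∧
    (l + r + 1 : ℝ) ≤ 15000 * (T.size : ℝ) ^ (0.48 : ℝ) := by
  induction hn : T.size using Nat.strong_induction_on generalizing T with
  | _ n ih =>
    subst hn
    obtain ⟨a, b, hpath, hfit⟩ := exists_hasPath_fits T
    have hT : (1 : ℝ) ≤ (T.size : ℝ) ^ (0.48 : ℝ) :=
      Real.one_le_rpow (by exact_mod_cast T.size_pos) (by norm_num)
    unfold Fits at hfit
    have key : ∀ m : ℕ, (m : ℝ) ^ (0.48 : ℝ) ≤ 0.9998 * (T.size : ℝ) ^ (0.48 : ℝ) →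
        ∀ S : OrderedTree, S.size ≤ m → ∃ Γ l r, IsGood Γ S l r ∧
          l + r + 2 ≤ ⌊15000 * (m : ℝ) ^ (0.48 : ℝ)⌋₊ + 1 := by
      intro m hm S hS
      -- The factor 0.9998 < 1 makes the recursion descend.
      have hlt : S.size < T.size := by
        by_contra! hc
        have : (T.size : ℝ) ^ (0.48 : ℝ) ≤ (m : ℝ) ^ (0.48 : ℝ) :=
          Real.rpow_le_rpow (by positivity) (by exact_mod_cast hc.trans hS) (by norm_num)
        linarith
      obtain ⟨Γ, l, r, hg, hlr⟩ := ih S.size hlt S rfl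
      refine ⟨Γ, l, r, hg, ?_⟩
      have h1 : (S.size : ℝ) ^ (0.48 : ℝ) ≤ (m : ℝ) ^ (0.48 : ℝ) :=
        Real.rpow_le_rpow (by positivity) (by exact_mod_cast hS) (by norm_num)
      have : l + r + 1 ≤ ⌊15000 * (m : ℝ) ^ (0.48 : ℝ)⌋₊ := by
        refine Nat.le_floor ?_
        push_cast
        linarith
      omega
    have ha0 : (0 : ℝ) ≤ (a : ℝ) ^ (0.48 : ℝ) := by positivity
    have hb0 : (0 : ℝ) ≤ (b : ℝ) ^ (0.48 : ℝ) := by positivity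
    obtain ⟨Γ, hg⟩ := exists_isGood_of_hasPath hpath (key a (by linarith)) (key b (by linarith))
    refine ⟨Γ, _, _, hg, ?_⟩
    have h1 := Nat.floor_le (show 0 ≤ 15000 * (a : ℝ) ^ (0.48 : ℝ) by positivity)
    have h2 := Nat.floor_le (show 0 ≤ 15000 * (b : ℝ) ^ (0.48 : ℝ) by positivity)
    push_cast
    -- The total is at most 15000 · 0.9998 n^p + 3, where 3 counts one extra column on each side and
    -- the path itself. As 15000 · 0.0002 = 3 and n^p ≥ 1, the bound is reproduced.
    linarith

end GridDrawing

theorem mainTheorem2 :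
    ∃ C : ℝ, 0 < C ∧ ∀ T : OrderedTree, ∃ Γ : GridDrawing,
      Γ.IsGLR T ∧ Γ.IsStrictlyUpward T ∧
      (∀ a i, a ++ [i] ∈ T.nodes → (Γ.bends (a ++ [i])).length ≤ 1) ∧
      (Γ.width T : ℝ) ≤ C * (T.size : ℝ) ^ (0.48 : ℝ) ∧
      (Γ.height T : ℝ) ≤ C * (T.size : ℝ) := by
  refine ⟨15000, by norm_num, fun T => ?_⟩
  obtain ⟨Γ, l, r, hg, hlr⟩ := GridDrawing.exists_isGood T
  refine ⟨Γ, hg.isGLR, hg.isStrictlyUpward, hg.bends_length, ?_, ?_⟩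
  · have : (Γ.width T : ℝ) ≤ l + r + 1 := by exact_mod_cast hg.width_le
    exact this.trans hlr
  · have : (Γ.height T : ℝ) ≤ 2 * T.size := by exact_mod_cast hg.height_le
    have h0 : (0 : ℝ) ≤ T.size := by positivity
    linarith
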